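/- All problems are multi-valued partial functions $F :\subseteq \omega^\omega \rightrightarrows \omega^\omega$, regarded as relations; $\mathrm{dom}(F)$ is the set of $f$ with $F(f) \neq \emptyset$. Sets are coded by characteristic functions, colorings of pairs and graphs are coded by functions in the standard way, and $\langle f, g\rangle$ is given by $\langle f,g\rangle(2n) = f(n)$, $\langle f,g\rangle(2n+1) = g(n)$. $F \leq_{\mathrm W} G$ means that there are Turing functionals $\Phi, \Psi$ such that $\Phi(f) \in \mathrm{dom}(G)$ for all $f \in \mathrm{dom}(F)$, and $\Psi(\langle f, g\rangle) \in F(f)$ for all $f \in \mathrm{dom}(F)$ and $g \in G(\Phi(f))$. The product $F \times G$ maps $\langle f, g\rangle$ to the set of all $\langle a, b\rangle$ with $a \in F(f)$, $b \in G(g)$. The composition $F \circ G$ has domain $\{x \in \mathrm{dom}(G) : G(x) \subseteq \mathrm{dom}(F)\}$ and $(F \circ G)(x) = \bigcup_{y \in G(x)} F(y)$. The compositional product $F \ast G$ is (any representative of the Weihrauch degree of) the $\leq_{\mathrm W}$-maximum of $\{F_0 \circ G_0 : F_0 \leq_{\mathrm W} F,\ G_0 \leq_{\mathrm W} G\}$;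 repeated products without parentheses are bracketed to the left. The problems are as follows. - $\mathsf{RT}^2_2$: an instance is a coloring $c : [\omega]^2 \to \{0,1\}$; a solution is an infinite $H \subseteq \omega$ that is homogeneous for $c$. - $\mathsf{SRT}^2_2$: the restriction of $\mathsf{RT}^2_2$ to stable colorings, i.e. those for which $\lim_s c(n,s)$ exists for every $n$. - $\mathsf{wRSg}$: an instance is an infinite simple graph $G = (V,E)$ with $V \subseteq \omega$; a solution is an infinite $H \subseteq V$ such that for every $v \in H$, with $N(v)$ the set of neighbors of $v$, either $H \cap N(v)$ is infinite or $|H \cap N(v)| \leq 1$. - $\mathsf{wRSgr}$: as $\mathsf{wRSg}$, but for every $v \in H$ either $H \cap N(v)$ is infinite or $H \cap N(v) = \emptyset$. - $\mathsf{LPO}$: an instance is any $p \in \omega^\omega$; the output is $0$ if $p(n) = 0$ for some $n$, and $1$ otherwise. Theorem. The compositional product $F \ast G$ (that is, the maximum above) exists for all $F, G$, and 1. $\mathsf{SRT}^2_2 \leq_{\mathrm W} \mathsf{LPO} \ast \mathsf{wRSgr}$; 2. $\mathsf{SRT}^2_2 \leq_{\mathrm W} (\mathsf{LPO} \times \mathsf{LPO})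 \ast \mathsf{wRSg}$; 3. consequently, $\mathsf{RT}^2_2 \leq_{\mathrm W} \mathsf{wRSg} \ast \mathsf{wRSg} \ast \mathsf{wRSg}$. -/

import Mathlib

namespace Weihrauch

/-- The Turing functionals `Φ :⊆ ω^ω → ω^ω`: `Φ f n` is the (possibly divergent) output on input
`n` of one fixed program with oracle `f`.  This is the uniform version of `Nat.RecursiveIn`: the
least class containing the basic functions and the oracle and closed under pairing, composition,
primitive recursion and unbounded search. -/
inductive TuringFunctional : ((ℕ → ℕ) → ℕ →. ℕ) → Prop
  | zero : TuringFunctional fun _ _ => Part.some 0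
  | succ : TuringFunctional fun _ n => Part.some (n + 1)
  | left : TuringFunctional fun _ n => Part.some n.unpair.1
  | right : TuringFunctional fun _ n => Part.some n.unpair.2
  | oracle : TuringFunctional fun f n => Part.some (f n)
  | pair {Φ Ψ : (ℕ → ℕ) → ℕ →. ℕ} (hΦ : TuringFunctional Φ) (hΨ : TuringFunctional Ψ) :
      TuringFunctional fun f n => (Φ f n).bind fun a => (Ψ f n).map fun b => Nat.pair a b
  | comp {Φ Ψ : (ℕ → ℕ) → ℕ →. ℕ} (hΦ : TuringFunctional Φ) (hΨ : TuringFunctional Ψ) :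
      TuringFunctional fun f n => (Ψ f n).bind (Φ f)
  | prec {Φ Ψ : (ℕ → ℕ) → ℕ →. ℕ} (hΦ : TuringFunctional Φ) (hΨ : TuringFunctional Ψ) :
      TuringFunctional fun f p =>
        Nat.rec (Φ f p.unpair.1)
          (fun y IH => IH.bind fun i => Ψ f (Nat.pair p.unpair.1 (Nat.pair y i))) p.unpair.2
  | rfind {Φ : (ℕ → ℕ) → ℕ →. ℕ} (hΦ : TuringFunctional Φ) :
      TuringFunctional fun f a =>
        Nat.rfind fun n => (Φ f (Nat.pair a n)).map fun m => decide (m = 0)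

/-- `Φ(f)` is defined (that is, total) and equal to `g`. -/
def Maps (Φ : (ℕ → ℕ) → ℕ →. ℕ) (f g : ℕ → ℕ) : Prop :=
  ∀ n, g n ∈ Φ f n

/-- The pairing `⟨f, g⟩` with `⟨f, g⟩(2n) = f(n)` and `⟨f, g⟩(2n+1) = g(n)`. -/
def join (f g : ℕ → ℕ) : ℕ → ℕ :=
  fun n => if n % 2 = 0 then f (n / 2) else g (n / 2)

/-- Multi-valued partial functions `F :⊆ ω^ω ⇉ ω^ω`; `F f` is the set of solutions to `f`, and it
is empty if `f` is not an instance. -/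
abbrev Problem : Type := (ℕ → ℕ) → Set (ℕ → ℕ)

/-- The domain (the set of instances) of a multi-valued function. -/
def Problem.dom (F : Problem) : Set (ℕ → ℕ) := {f | (F f).Nonempty}

/-- Weihrauch reducibility. -/
def WeihrauchLE (F G : Problem) : Prop :=
  ∃ Φ Ψ : (ℕ → ℕ) → ℕ →. ℕ, TuringFunctional Φ ∧ TuringFunctional Ψ ∧
    ∀ f ∈ F.dom, ∃ p, Maps Φ f p ∧ p ∈ G.dom ∧
      ∀ g ∈ G p, ∃ h, Maps Ψ (join f g) h ∧ h ∈ F f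

/-- Weihrauch reducibility. -/
infix:50 " ≤ᵂ " => WeihrauchLE

/-- The composition `F ∘ G` of multi-valued functions, with the usual domain
`{x ∈ dom G : G(x) ⊆ dom F}`.  With this convention any two multi-valued functions on `ω^ω` are
composable. -/
def Problem.comp (F G : Problem) : Problem :=
  fun x => {z | G x ⊆ F.dom ∧ ∃ y ∈ G x, z ∈ F y}

/-- The parallel product `F × G`. -/
def Problem.prod (F G : Problem) : Problem :=
  fun p => {r | ∃ f g a b, p = join f g ∧ a ∈ F f ∧ b ∈ G g ∧ r = join a b}

/-- `P` is, up to Weihrauch degree, the `≤ᵂ`-maximum of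
`{F₀ ∘ G₀ : F₀ ≤ᵂ F, G₀ ≤ᵂ G}`. -/
def IsCompositionalProduct (F G P : Problem) : Prop :=
  (∃ F₀ G₀ : Problem, F₀ ≤ᵂ F ∧ G₀ ≤ᵂ G ∧ P ≤ᵂ F₀.comp G₀ ∧ F₀.comp G₀ ≤ᵂ P) ∧
  ∀ F₀ G₀ : Problem, F₀ ≤ᵂ F → G₀ ≤ᵂ G → F₀.comp G₀ ≤ᵂ P

/-- The compositional product `F ∗ G`: a chosen representative of the Weihrauch degree of the
maximum (one exists for all `F` and `G`). -/
noncomputable def compProd (F G : Problem) : Problem :=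
  Classical.epsilon (IsCompositionalProduct F G)

/-- The compositional product (left associative). -/
infixl:70 " ∗ " => compProd

/-- The characteristic function of a set of natural numbers. -/
noncomputable def charFn (A : Set ℕ) : ℕ → ℕ := A.indicator fun _ => 1

/-- `c` codes a colouring `[ω]² → {0,1}`: the colour of `{x, y}` with `x < y` is
`c (Nat.pair x y)`; the other values of `c` are irrelevant. -/
def IsColoring (c : ℕ → ℕ) : Prop :=
  ∀ x y, x < y → c (Nat.pair x y) = 0 ∨ c (Nat.pair x y) = 1

/-- `lim_s c(x, s)` exists for every `x`. -/
def IsStable (c : ℕ → ℕ) : Prop :=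
  ∀ x, ∃ i, ∀ᶠ s in Filter.atTop, c (Nat.pair x s) = i

/-- All pairs from `H` have the same colour. -/
def IsHomogeneous (c : ℕ → ℕ) (H : Set ℕ) : Prop :=
  ∃ i, ∀ x ∈ H, ∀ y ∈ H, x < y → c (Nat.pair x y) = i

/-- Ramsey's theorem for pairs and two colours. -/
def RTPairs : Problem :=
  fun c => {h | IsColoring c ∧ ∃ H : Set ℕ, H.Infinite ∧ IsHomogeneous c H ∧ h = charFn H}

/-- Stable Ramsey's theorem for pairs and two colours. -/
def SRTPairs : Problem :=
  fun c => {h | IsColoring c ∧ IsStable c ∧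
    ∃ H : Set ℕ, H.Infinite ∧ IsHomogeneous c H ∧ h = charFn H}

/-- A simple graph `(V, E)` with `V ⊆ ω`, that is, a subgraph of the complete graph on `ω`. -/
abbrev Graph : Type := (⊤ : SimpleGraph ℕ).Subgraph

/-- The code `⟨V, E⟩` of a graph, where `E` is the set of (coded) pairs `(x, y)` of adjacent
vertices with `x < y`. -/
noncomputable def Graph.code (G : Graph) : ℕ → ℕ :=
  join (charFn G.verts) (charFn {n | n.unpair.1 < n.unpair.2 ∧ G.Adj n.unpair.1 n.unpair.2})

/-- The weak Rival-Sands theorem. -/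
def wRSg : Problem :=
  fun p => {h | ∃ G : Graph, p = G.code ∧ G.verts.Infinite ∧
    ∃ H : Set ℕ, H ⊆ G.verts ∧ H.Infinite ∧
      (∀ v ∈ H, (H ∩ G.neighborSet v).Infinite ∨ (H ∩ G.neighborSet v).encard ≤ 1) ∧
      h = charFn H}

/-- The refined weak Rival-Sands theorem. -/
def wRSgr : Problem :=
  fun p => {h | ∃ G : Graph, p = G.code ∧ G.verts.Infinite ∧
    ∃ H : Set ℕ, H ⊆ G.verts ∧ H.Infinite ∧
      (∀ v ∈ H, (H ∩ G.neighborSet v).Infinite ∨ H ∩ G.neighborSet v = ∅) ∧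
      h = charFn H}

open Classical in
/-- The limited principle of omniscience; the output bit is coded by the constant function. -/
noncomputable def LPO : Problem :=
  fun p => {fun _ => if ∃ n, p n = 0 then 0 else 1}

end Weihrauch

open Weihrauch

/-! For a stable colouring, let the edges be the pairs of colour 1 and let H be a solution for this
graph. A vertex with infinitely many neighbours in H has limit colour 1 along H; one with finitely
many has limit colour 0. In a `wRSgr` solution, having one neighbour certifies limit colour 1. One
`LPO` question, whether H has an edge, suffices: if so, the non-isolated vertices form an infinite
enumerable set of limit colour 1; if not, all limits are 0. Once an infinite enumerable set with a
known common limit colour is available, greedy thinning gives a homogeneous set (`exists_thinning`).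

In a `wRSg` solution the certificate is a pair of neighbours. Let B be the set of vertices with two
neighbours in H. Two elements of B are adjacent to almost all of H, so B is then cofinite in H.
Otherwise at most one vertex must be discarded, and it can be found by search once it is known to
exist. Hence two questions: is B nonempty, and has it two elements?

For Ramsey's theorem for pairs, order the numbers x lexicographically by their colour sequences i ↦
c(i, x), and join x < y when the sequence increases. From a `wRSg` solution one computes an infinite
set K along which these sequences are eventually lexicographically monotone, hence pointwise
convergent; so c is stable on K (`RTPairs_le_SRTPairsOn_wRSg`). The procedure is uniform and asks no
`LPO` question. This is why the stable principle is needed relative to a set K (`SRTPairsOn`).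
Finally `LPO × LPO` itself reduces to `wRSg` (`LPO_prod_LPO_le_wRSg`), and monotonicity of the
compositional product gives three copies of `wRSg`.

The maximum defining the compositional product exists because a universal functional lets one
composition simulate all others. -/

namespace Weihrauch

open Encodable Filter

/-! ### Closure properties of Turing functionals -/

namespace TuringFunctional

theorem of_eq {Φ Ψ : (ℕ → ℕ) → ℕ →. ℕ} (hΦ : TuringFunctional Φ) (h : ∀ f n, Φ f n = Ψ f n) :
    TuringFunctional Ψ :=
  (funext₂ h : Φ = Ψ) ▸ hΦ

theorem of_partrec {g : ℕ →. ℕ} (hg : Nat.Partrec g) : TuringFunctional fun _ n => g n := by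
  induction hg with
  | zero => exact zero
  | succ => exact succ
  | left => exact left
  | right => exact right
  | @pair f g _ _ hf hg =>
    exact (hf.pair hg).of_eq fun _ n => by simp [Seq.seq]
  | comp _ _ hf hg => exact hf.comp hg
  | prec _ _ hf hg => exact hf.prec hg
  | rfind _ hf => exact hf.rfind

theorem of_primrec {g : ℕ → ℕ} (hg : Primrec g) : TuringFunctional fun _ n => Part.some (g n) :=
  of_partrec (Nat.Partrec.of_primrec (Primrec.nat_iff.1 hg))

theorem map {Φ : (ℕ → ℕ) → ℕ →. ℕ} (hΦ : TuringFunctional Φ) {g : ℕ → ℕ} (hg : Primrec g) :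
    TuringFunctional fun f n => (Φ f n).map g :=
  ((of_primrec hg).comp hΦ).of_eq fun _ _ => Part.bind_some_eq_map _ _

theorem map₂ {Φ Ψ : (ℕ → ℕ) → ℕ →. ℕ} (hΦ : TuringFunctional Φ) (hΨ : TuringFunctional Ψ)
    {g : ℕ → ℕ → ℕ} (hg : Primrec₂ g) :
    TuringFunctional fun f n => (Φ f n).bind fun a => (Ψ f n).map fun b => g a b := by
  refine ((hΦ.pair hΨ).map (g := fun n => g n.unpair.1 n.unpair.2)
    (hg.comp (Primrec.fst.comp .unpair) (Primrec.snd.comp .unpair))).of_eq fun f n => ?_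
  simp [Part.map_bind, Part.map_map, Function.comp_def]

theorem substPrimrec {Φ : (ℕ → ℕ) → ℕ →. ℕ} (hΦ : TuringFunctional Φ) {g : ℕ → ℕ}
    (hg : Primrec g) : TuringFunctional fun f n => Φ f (g n) :=
  (hΦ.comp (of_primrec hg)).of_eq fun f _ => Part.bind_some _ (Φ f)

end TuringFunctional

/-! ### Oracle computations with bounded use -/

/-- The initial segment of `f` of length `k`. -/
def initSeg (f : ℕ → ℕ) (k : ℕ) : List ℕ := (List.range k).map f

theorem initSeg_succ (f : ℕ → ℕ) (k : ℕ) : initSeg f (k + 1) = initSeg f k ++ [f k] := by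
  simp [initSeg, List.range_succ]

theorem length_initSeg (f : ℕ → ℕ) (k : ℕ) : (initSeg f k).length = k := by
  simp [initSeg]

theorem getElem?_initSeg {f : ℕ → ℕ} {k i : ℕ} (h : i < k) : (initSeg f k)[i]? = some (f i) := by
  simp [initSeg, h]

theorem TuringFunctional.encode_initSeg :
    TuringFunctional fun f n => Part.some (encode (initSeg f n)) := by
  have h1 : TuringFunctional fun _ _ => Part.some (encode ([] : List ℕ)) :=
    of_primrec (Primrec.const _)
  have hg : Primrec₂ fun (v p : ℕ) => encode ((Denumerable.ofNat (List ℕ) p.unpair.2.unpair.2) ++ [v]) := by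
    refine Primrec.encode.comp (Primrec.list_concat.comp ((Primrec.ofNat _).comp ?_) Primrec.fst)
    exact Primrec.snd.comp (Primrec.unpair.comp (Primrec.snd.comp (Primrec.unpair.comp Primrec.snd)))
  have hy : Primrec fun p : ℕ => p.unpair.2.unpair.1 :=
    Primrec.fst.comp (Primrec.unpair.comp (Primrec.snd.comp Primrec.unpair))
  have h2 := map₂ (oracle.substPrimrec hy) (of_primrec Primrec.id) hg
  have h3 := (h1.prec h2).substPrimrec (Primrec₂.natPair.comp (Primrec.const 0) Primrec.id)
  refine h3.of_eq fun f n => ?_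
  simp only [id, Nat.unpair_pair]
  induction n with
  | zero => simp [initSeg]
  | succ n ih =>
    refine (congrArg (fun q : Part ℕ => q.bind _) ih).trans ?_
    simp [initSeg_succ]

section OraclePrimrec

variable {α β γ : Type*} [Primcodable α] [Primcodable β] [Primcodable γ]

/-- `F` is primitive recursive in the oracle, with a use bounded primitively recursively in the
argument alone. -/
def OraclePrimrec (F : (ℕ → ℕ) → α → β) : Prop :=
  ∃ (u : α → ℕ) (G : List ℕ → α → β), Primrec u ∧ Primrec₂ G ∧
    ∀ f a k, u a ≤ k → G (initSeg f k) a = F f a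

/-- `P` is primitive recursive in the oracle, with a use bounded primitively recursively in the
argument alone. -/
def OraclePrimrecPred (P : (ℕ → ℕ) → α → Prop) : Prop :=
  ∃ (u : α → ℕ) (G : List ℕ → α → Prop), Primrec u ∧ PrimrecRel G ∧
    ∀ f a k, u a ≤ k → (G (initSeg f k) a ↔ P f a)

theorem _root_.Primrec.oraclePrimrec {g : α → β} (hg : Primrec g) : OraclePrimrec fun _ a => g a :=
  ⟨fun _ => 0, fun _ a => g a, .const 0, hg.comp .snd, fun _ _ _ _ => rfl⟩

theorem _root_.PrimrecPred.oraclePrimrecPred {p : α → Prop} (hp : PrimrecPred p) :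
    OraclePrimrecPred fun _ a => p a :=
  ⟨fun _ => 0, fun _ a => p a, .const 0, hp.comp .snd, fun _ _ _ _ => Iff.rfl⟩

namespace OraclePrimrec

theorem of_eq {F G : (ℕ → ℕ) → α → β} (hF : OraclePrimrec F) (h : ∀ f a, F f a = G f a) :
    OraclePrimrec G :=
  (funext₂ h : F = G) ▸ hF

theorem oracle {g : α → ℕ} (hg : Primrec g) : OraclePrimrec fun f a => f (g a) := by
  refine ⟨fun a => g a + 1, fun σ a => σ[g a]?.getD 0, Primrec.succ.comp hg, ?_, ?_⟩
  · exact Primrec.option_getD.comp (Primrec.list_getElem?.comp .fst (hg.comp .snd)) (.const 0)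
  · intro f a k hk
    simp [getElem?_initSeg (f := f) (show g a < k from hk)]

theorem pair {F : (ℕ → ℕ) → α → β} {G : (ℕ → ℕ) → α → γ} (hF : OraclePrimrec F)
    (hG : OraclePrimrec G) : OraclePrimrec fun f a => (F f a, G f a) := by
  obtain ⟨u, F', hu, hF', h⟩ := hF
  obtain ⟨v, G', hv, hG', h'⟩ := hG
  refine ⟨fun a => max (u a) (v a), fun σ a => (F' σ a, G' σ a), Primrec.nat_max.comp hu hv,
    Primrec.pair hF' hG', fun f a k hk => ?_⟩
  simp only
  rw [h f a k (le_trans (le_max_left _ _) hk), h' f a k (le_trans (le_max_right _ _) hk)]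

theorem map {F : (ℕ → ℕ) → α → β} (hF : OraclePrimrec F) {h : β → γ} (hh : Primrec h) :
    OraclePrimrec fun f a => h (F f a) := by
  obtain ⟨u, F', hu, hF', H⟩ := hF
  exact ⟨u, fun σ a => h (F' σ a), hu, hh.comp hF', fun f a k hk => by simp only [H f a k hk]⟩

theorem pred {F : (ℕ → ℕ) → α → β} (hF : OraclePrimrec F) {p : β → Prop} (hp : PrimrecPred p) :
    OraclePrimrecPred fun f a => p (F f a) := by
  obtain ⟨u, F', hu, hF', H⟩ := hF
  exact ⟨u, fun σ a => p (F' σ a), hu, hp.comp hF', fun f a k hk => by simp only [H f a k hk]⟩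

theorem rel {F : (ℕ → ℕ) → α → β} {G : (ℕ → ℕ) → α → γ} (hF : OraclePrimrec F)
    (hG : OraclePrimrec G) {R : β → γ → Prop} (hR : PrimrecRel R) :
    OraclePrimrecPred fun f a => R (F f a) (G f a) :=
  (hF.pair hG).pred hR

theorem eq {F G : (ℕ → ℕ) → α → β} (hF : OraclePrimrec F) (hG : OraclePrimrec G) :
    OraclePrimrecPred fun f a => F f a = G f a :=
  hF.rel hG Primrec.eq

theorem eq_const {F : (ℕ → ℕ) → α → β} (hF : OraclePrimrec F) (b : β) :
    OraclePrimrecPred fun f a => F f a = b :=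
  hF.eq (Primrec.const b).oraclePrimrec

theorem comp {F : (ℕ → ℕ) → β → γ} (hF : OraclePrimrec F) {g : α → β} (hg : Primrec g) :
    OraclePrimrec fun f a => F f (g a) := by
  obtain ⟨u, F', hu, hF', h⟩ := hF
  exact ⟨fun a => u (g a), fun σ a => F' σ (g a), hu.comp hg, hF'.comp .fst (hg.comp .snd),
    fun f a k hk => h f (g a) k hk⟩

end OraclePrimrec

namespace OraclePrimrecPred

variable {P Q : (ℕ → ℕ) → α → Prop}

theorem of_iff (hP : OraclePrimrecPred P) (h : ∀ f a, Q f a ↔ P f a) : OraclePrimrecPred Q := by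
  have : Q = P := by ext f a; exact h f a
  exact this ▸ hP

theorem not (hP : OraclePrimrecPred P) : OraclePrimrecPred fun f a => ¬ P f a := by
  obtain ⟨u, P', hu, hP', h⟩ := hP
  exact ⟨u, fun σ a => ¬ P' σ a, hu, PrimrecPred.not hP', fun f a k hk => not_congr (h f a k hk)⟩

theorem and (hP : OraclePrimrecPred P) (hQ : OraclePrimrecPred Q) :
    OraclePrimrecPred fun f a => P f a ∧ Q f a := by
  obtain ⟨u, P', hu, hP', h⟩ := hP
  obtain ⟨v, Q', hv, hQ', h'⟩ := hQ
  exact ⟨fun a => max (u a) (v a), fun σ a => P' σ a ∧ Q' σ a, Primrec.nat_max.comp hu hv,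
    PrimrecPred.and hP' hQ', fun f a k hk => and_congr (h f a k (le_trans (le_max_left _ _) hk))
      (h' f a k (le_trans (le_max_right _ _) hk))⟩

theorem or (hP : OraclePrimrecPred P) (hQ : OraclePrimrecPred Q) :
    OraclePrimrecPred fun f a => P f a ∨ Q f a :=
  (hP.not.and hQ.not).not.of_iff fun f a => by tauto

theorem imp (hP : OraclePrimrecPred P) (hQ : OraclePrimrecPred Q) :
    OraclePrimrecPred fun f a => P f a → Q f a :=
  (hP.not.or hQ).of_iff fun f a => by tauto

theorem comp {P : (ℕ → ℕ) → β → Prop} (hP : OraclePrimrecPred P) {g : α → β} (hg : Primrec g) :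
    OraclePrimrecPred fun f a => P f (g a) := by
  obtain ⟨u, P', hu, hP', h⟩ := hP
  exact ⟨fun a => u (g a), fun σ a => P' σ (g a), hu.comp hg, hP'.comp .fst (hg.comp .snd),
    fun f a k hk => h f (g a) k hk⟩

theorem forall_mem {P : (ℕ → ℕ) → β × α → Prop} (hP : OraclePrimrecPred P) {l : α → List β}
    (hl : Primrec l) : OraclePrimrecPred fun f a => ∀ x ∈ l a, P f (x, a) := by
  obtain ⟨u, P', hu, hP', h⟩ := hP
  -- The use of a bounded quantifier is the maximum of the uses of its finitely many instances.
  refine ⟨fun a => ((l a).map fun x => u (x, a)).foldr max 0, fun σ a => ∀ x ∈ l a, P' σ (x, a),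
    ?_, ?_, fun f a k hk => ?_⟩
  · have hm : Primrec fun a => (l a).map fun x => u (x, a) :=
      Primrec.list_map hl (hu.comp (Primrec.pair .snd .fst))
    exact Primrec.list_foldr (h := fun _ q => max q.1 q.2) hm (Primrec.const 0)
      (Primrec.nat_max.comp (Primrec.fst.comp .snd) (Primrec.snd.comp .snd))
  · have : PrimrecRel fun (x : β) (q : List ℕ × α) => P' q.1 (x, q.2) :=
      hP'.comp (Primrec.fst.comp Primrec.snd) (Primrec.pair .fst (Primrec.snd.comp .snd))
    exact this.forall_mem_list.comp (hl.comp .snd) Primrec.id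
  · have key : ∀ l' : List β, (l'.map fun x => u (x, a)).foldr max 0 ≤ k →
        ∀ x ∈ l', u (x, a) ≤ k := by
      intro l' hl'
      induction l' with
      | nil => simp
      | cons y t ih => simp at hl' ⊢; exact ⟨hl'.1, ih hl'.2⟩
    exact forall₂_congr fun x hx => h f (x, a) k (key _ hk x hx)

theorem forall_lt {P : (ℕ → ℕ) → ℕ × α → Prop} (hP : OraclePrimrecPred P) {b : α → ℕ}
    (hb : Primrec b) : OraclePrimrecPred fun f a => ∀ n < b a, P f (n, a) :=
  (hP.forall_mem (Primrec.list_range.comp hb)).of_iff fun f a => by simp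

theorem exists_lt {P : (ℕ → ℕ) → ℕ × α → Prop} (hP : OraclePrimrecPred P) {b : α → ℕ}
    (hb : Primrec b) : OraclePrimrecPred fun f a => ∃ n < b a, P f (n, a) :=
  (hP.not.forall_lt hb).not.of_iff fun f a => by simp

open Classical in
theorem ite (hP : OraclePrimrecPred P) {F G : (ℕ → ℕ) → α → β} (hF : OraclePrimrec F)
    (hG : OraclePrimrec G) : OraclePrimrec fun f a => if P f a then F f a else G f a := by
  obtain ⟨v, P', hv, hP', h⟩ := hP
  obtain ⟨u, H, hu, hH, h'⟩ := hF.pair hG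
  refine ⟨fun a => max (u a) (v a), fun σ a => if P' σ a then (H σ a).1 else (H σ a).2,
    Primrec.nat_max.comp hu hv, Primrec.ite hP' (Primrec.fst.comp hH) (Primrec.snd.comp hH),
    fun f a k hk => ?_⟩
  simp only
  rw [h' f a k (le_trans (le_max_left _ _) hk)]
  simp [h f a k (le_trans (le_max_right _ _) hk)]

end OraclePrimrecPred

/-- Load an initial segment of the oracle as long as the use; the rest is an oracle-free primitive
recursive computation on that list. -/
theorem OraclePrimrec.turingFunctional {F : (ℕ → ℕ) → ℕ → ℕ} (hF : OraclePrimrec F) :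
    TuringFunctional fun f n => Part.some (F f n) := by
  obtain ⟨u, G, hu, hG, h⟩ := hF
  have hg : Primrec₂ fun (s n : ℕ) => G (Denumerable.ofNat (List ℕ) s) n :=
    hG.comp ((Primrec.ofNat _).comp .fst) .snd
  refine (TuringFunctional.map₂ (TuringFunctional.encode_initSeg.substPrimrec hu)
    (TuringFunctional.of_primrec .id) hg).of_eq fun f n => ?_
  simp [h f n _ le_rfl]

open Classical in
/-- Unbounded search for a witness of a primitive recursive relation in the oracle. -/
theorem OraclePrimrecPred.rfind {P : (ℕ → ℕ) → ℕ × ℕ → Prop} (hP : OraclePrimrecPred P) :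
    TuringFunctional fun f n => Nat.rfind fun m => Part.some (decide (P f (n, m))) := by
  have h : OraclePrimrec fun f (p : ℕ) => if P f p.unpair then 0 else 1 :=
    (hP.comp Primrec.unpair).ite (Primrec.const 0).oraclePrimrec (Primrec.const 1).oraclePrimrec
  refine h.turingFunctional.rfind.of_eq fun f n => congrArg _ (funext fun m => ?_)
  by_cases hp : P f (n, m) <;> simp [hp]

end OraclePrimrec

/-! ### Greedy construction of infinite sets -/

/-- The list `[w (n - 1), …, w 0]`. -/
def history (w : ℕ → ℕ) : ℕ → List ℕ
  | 0 => []
  | n + 1 => w n :: history w n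

theorem mem_history {w : ℕ → ℕ} {n x : ℕ} : x ∈ history w n ↔ ∃ m < n, x = w m := by
  induction n with
  | zero => simp [history]
  | succ n ih =>
    simp only [history, List.mem_cons, ih, Nat.lt_succ_iff_lt_or_eq]
    aesop

theorem length_history (w : ℕ → ℕ) (n : ℕ) : (history w n).length = n := by
  induction n <;> simp_all [history]

open Classical in
-- Each step searches for the least w admissible after the history σ, newest entry first; `I` is an
-- invariant that keeps the search from failing. A code w carries a number w.unpair.1 and a
-- certificate for it. The numbers increase strictly, so their range is decidable and not just
-- enumerable.
theorem exists_greedy {E : (ℕ → ℕ) → List ℕ × ℕ → Prop} (hE : OraclePrimrecPred E) :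
    ∃ Ψ, TuringFunctional Ψ ∧ ∀ (f : ℕ → ℕ) (I : List ℕ → Prop), I [] →
      (∀ σ, I σ → ∃ w, E f (σ, w)) → (∀ σ w, I σ → E f (σ, w) → I (w :: σ)) →
      (∀ σ w, E f (σ, w) → ∀ x ∈ σ, x.unpair.1 < w.unpair.1) →
      ∃ w : ℕ → ℕ, (∀ n, I (history w n) ∧ E f (history w n, w n)) ∧
        Maps Ψ f (charFn (Set.range fun n => (w n).unpair.1)) := by
  -- The step of the primitive recursion receives ⟨0, ⟨y, i⟩⟩, where i codes the history.
  have hE' : OraclePrimrecPred fun f (p : ℕ × ℕ) =>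
      E f (Denumerable.ofNat (List ℕ) p.1.unpair.2.unpair.2, p.2) := by
    refine hE.comp (Primrec.pair ((Primrec.ofNat _).comp ?_) .snd)
    exact Primrec.snd.comp (Primrec.unpair.comp (Primrec.snd.comp (Primrec.unpair.comp .fst)))
  have hstep : Primrec₂ fun p w : ℕ =>
      encode (w :: Denumerable.ofNat (List ℕ) p.unpair.2.unpair.2) := by
    refine Primrec.encode.comp (Primrec.list_cons.comp .snd ((Primrec.ofNat _).comp ?_))
    exact Primrec.snd.comp (Primrec.unpair.comp (Primrec.snd.comp (Primrec.unpair.comp .fst)))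
  have h1 : TuringFunctional fun _ _ => Part.some (encode ([] : List ℕ)) :=
    .of_primrec (Primrec.const _)
  have h2 := h1.prec (.map₂ (.of_primrec .id) hE'.rfind hstep)
  have hout : Primrec₂ fun s m : ℕ =>
      if ∃ x ∈ Denumerable.ofNat (List ℕ) s, x.unpair.1 = m then 1 else 0 := by
    have h : PrimrecRel fun (x m : ℕ) => x.unpair.1 = m :=
      Primrec.eq.comp (Primrec.fst.comp (Primrec.unpair.comp .fst)) .snd
    exact Primrec.ite (h.exists_mem_list.comp ((Primrec.ofNat _).comp .fst) .snd)
      (Primrec.const 1) (Primrec.const 0)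
  -- To decide whether m is in the range, m + 1 entries suffice, since the n-th number is at least
  -- n.
  refine ⟨_, TuringFunctional.map₂ (h2.substPrimrec (Primrec₂.natPair.comp (Primrec.const 0)
    Primrec.succ)) (.of_primrec .id) hout, fun f I h0 hex hI hlt => ?_⟩
  let w' : List ℕ → ℕ := fun σ => if h : ∃ w, E f (σ, w) then Nat.find h else 0
  let S : ℕ → List ℕ := fun n => Nat.rec [] (fun _ σ => w' σ :: σ) n
  let w : ℕ → ℕ := fun n => w' (S n)
  have hS : ∀ n, history w n = S n := by
    intro n
    induction n with
    | zero => rfl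
    | succ n ih => simp only [history, ih]; rfl
  have hw : ∀ n, I (history w n) → E f (history w n, w n) := by
    intro n hn
    have h := hex _ hn
    rw [hS] at h ⊢
    simp only [w, w', dif_pos h]
    exact Nat.find_spec h
  have hIn : ∀ n, I (history w n) := by
    intro n
    induction n with
    | zero => exact h0
    | succ n ih => exact hI _ _ ih (hw n ih)
  refine ⟨w, fun n => ⟨hIn n, hw n (hIn n)⟩, fun m => ?_⟩
  have hmono : StrictMono fun n => (w n).unpair.1 :=
    strictMono_nat_of_lt_succ fun n =>
      hlt _ _ (hw (n + 1) (hIn _)) _ (mem_history.2 ⟨n, n.lt_succ_self, rfl⟩)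
  have hst : ∀ n, Nat.rec (Part.some (encode ([] : List ℕ))) (fun y IH => IH.bind fun i =>
      (Part.some (id (Nat.pair 0 (Nat.pair y i)))).bind fun a =>
        (Nat.rfind fun m => Part.some (decide (E f (Denumerable.ofNat (List ℕ)
          (Nat.pair 0 (Nat.pair y i)).unpair.2.unpair.2, m)))).map fun b =>
          encode (b :: Denumerable.ofNat (List ℕ) a.unpair.2.unpair.2)) n =
      Part.some (encode (history w n)) := by
    intro n
    induction n with
    | zero => rfl
    | succ n ih =>
      refine (congrArg (fun q : Part ℕ => q.bind _) ih).trans ?_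
      have h := hex _ (hIn n)
      have hf : (Nat.rfind fun m => Part.some (decide (E f (history w n, m)))) =
          Part.some (w n) := by
        refine Part.eq_some_iff.2 (Nat.mem_rfind.2 ⟨by simpa using hw n (hIn n), fun {m} hm => ?_⟩)
        rw [hS] at h ⊢
        simp only [w, w', dif_pos h] at hm
        simpa using Nat.find_min h hm
      simp only [id, Part.bind_some, Nat.unpair_pair, Denumerable.ofNat_encode, hf]
      simp [history]
  refine Part.mem_bind_iff.2 ⟨encode (history w (m + 1)), ?_, ?_⟩
  · rw [Nat.unpair_pair]
    exact Part.eq_some_iff.1 (hst (m + 1))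
  have : (∃ x ∈ history w (m + 1), x.unpair.1 = m) ↔ m ∈ Set.range fun n => (w n).unpair.1 := by
    constructor
    · rintro ⟨x, hx, rfl⟩
      obtain ⟨k, -, rfl⟩ := mem_history.1 hx
      exact ⟨k, rfl⟩
    · rintro ⟨k, hk⟩
      exact ⟨w k, mem_history.2 ⟨k, Nat.lt_succ_of_le (hk ▸ hmono.le_apply), rfl⟩, hk⟩
  simp [this, charFn, Set.indicator_apply]

/-! ### Pairing and substitution of oracles -/

/-- The even part of `f`. -/
def left (f : ℕ → ℕ) : ℕ → ℕ := fun n => f (2 * n)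

/-- The odd part of `f`. -/
def right (f : ℕ → ℕ) : ℕ → ℕ := fun n => f (2 * n + 1)

@[simp] theorem left_join (f g : ℕ → ℕ) : left (join f g) = f := by
  ext n; simp [left, join]

@[simp] theorem right_join (f g : ℕ → ℕ) : right (join f g) = g := by
  ext n
  have : (2 * n + 1) / 2 = n := by omega
  simp [right, join, this]

theorem join_inj {f g f' g' : ℕ → ℕ} : join f g = join f' g' ↔ f = f' ∧ g = g' := by
  refine ⟨fun h => ⟨?_, ?_⟩, fun ⟨h, h'⟩ => by rw [h, h']⟩
  · simpa using congrArg left h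
  · simpa using congrArg right h

namespace TuringFunctional

theorem oracle_id : TuringFunctional fun f n => Part.some (f n) := oracle

theorem _root_.Weihrauch.maps_some {F : (ℕ → ℕ) → ℕ → ℕ} {f : ℕ → ℕ} :
    Maps (fun f n => Part.some (F f n)) f (F f) := fun _ => Part.mem_some _

theorem oracle_left : TuringFunctional fun f n => Part.some (Weihrauch.left f n) :=
  (OraclePrimrec.oracle Primrec.nat_double).turingFunctional

theorem oracle_right : TuringFunctional fun f n => Part.some (Weihrauch.right f n) :=
  (OraclePrimrec.oracle Primrec.nat_double_succ).turingFunctional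

theorem _root_.Weihrauch.maps_left (f g : ℕ → ℕ) :
    Maps (fun f n => Part.some (Weihrauch.left f n)) (join f g) f := by
  simpa using maps_some (F := Weihrauch.left) (f := join f g)

theorem _root_.Weihrauch.maps_right (f g : ℕ → ℕ) :
    Maps (fun f n => Part.some (Weihrauch.right f n)) (join f g) g := by
  simpa using maps_some (F := Weihrauch.right) (f := join f g)

theorem _root_.Weihrauch.maps_oracle_id (f : ℕ → ℕ) : Maps (fun f n => Part.some (f n)) f f :=
  maps_some (F := fun f => f)

/-- Substitution of a functional into the oracle of another one. -/
theorem exists_comp {Φ Ψ : (ℕ → ℕ) → ℕ →. ℕ} (hΦ : TuringFunctional Φ)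
    (hΨ : TuringFunctional Ψ) : ∃ Θ, TuringFunctional Θ ∧ ∀ f g, Maps Ψ f g → Θ f = Φ g := by
  induction hΦ with
  | zero => exact ⟨_, zero, fun _ _ _ => rfl⟩
  | succ => exact ⟨_, succ, fun _ _ _ => rfl⟩
  | left => exact ⟨_, .left, fun _ _ _ => rfl⟩
  | right => exact ⟨_, .right, fun _ _ _ => rfl⟩
  | oracle => exact ⟨_, hΨ, fun f g h => funext fun n => Part.eq_some_iff.2 (h n)⟩
  | pair _ _ h₁ h₂ =>
    obtain ⟨Θ₁, t₁, h₁⟩ := h₁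
    obtain ⟨Θ₂, t₂, h₂⟩ := h₂
    exact ⟨_, t₁.pair t₂, fun f g h => by simp only [h₁ f g h, h₂ f g h]; rfl⟩
  | comp _ _ h₁ h₂ =>
    obtain ⟨Θ₁, t₁, h₁⟩ := h₁
    obtain ⟨Θ₂, t₂, h₂⟩ := h₂
    exact ⟨_, t₁.comp t₂, fun f g h => by simp only [h₁ f g h, h₂ f g h]; rfl⟩
  | prec _ _ h₁ h₂ =>
    obtain ⟨Θ₁, t₁, h₁⟩ := h₁
    obtain ⟨Θ₂, t₂, h₂⟩ := h₂
    exact ⟨_, t₁.prec t₂, fun f g h => by simp only [h₁ f g h, h₂ f g h]; rfl⟩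
  | rfind _ h₁ =>
    obtain ⟨Θ₁, t₁, h₁⟩ := h₁
    exact ⟨_, t₁.rfind, fun f g h => by simp only [h₁ f g h]; rfl⟩

theorem exists_join {Φ Ψ : (ℕ → ℕ) → ℕ →. ℕ} (hΦ : TuringFunctional Φ)
    (hΨ : TuringFunctional Ψ) :
    ∃ Θ, TuringFunctional Θ ∧ ∀ f g h, Maps Φ f g → Maps Ψ f h → Maps Θ f (join g h) := by
  have hdiv : Primrec fun n : ℕ => n / 2 := Primrec.nat_div.comp .id (.const 2)
  have hsel : Primrec₂ fun (n p : ℕ) => if n % 2 = 0 then p.unpair.1 else p.unpair.2 :=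
    Primrec.ite (Primrec.eq.comp (Primrec.nat_mod.comp .fst (.const 2)) (.const 0))
      (Primrec.fst.comp (Primrec.unpair.comp .snd)) (Primrec.snd.comp (Primrec.unpair.comp .snd))
  refine ⟨_, map₂ (.of_primrec .id) ((hΦ.pair hΨ).substPrimrec hdiv) hsel,
    fun f g h hg hh n => ?_⟩
  simp only [Part.eq_some_iff.2 (hg (n / 2)), Part.eq_some_iff.2 (hh (n / 2))]
  simp [join]

end TuringFunctional

theorem Maps.unique {Φ : (ℕ → ℕ) → ℕ →. ℕ} {f g g' : ℕ → ℕ} (h : Maps Φ f g) (h' : Maps Φ f g') :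
    g = g' :=
  funext fun n => Part.mem_unique (h n) (h' n)

/-! ### A universal Turing functional -/

namespace TuringFunctional

/-- The use principle: a convergent computation queries only finitely much of the oracle. It turns a
functional into an oracle-free partial recursive function on finite strings, which has an ordinary
code. -/
theorem exists_approximation {Φ : (ℕ → ℕ) → ℕ →. ℕ} (hΦ : TuringFunctional Φ) :
    ∃ a : List ℕ × ℕ →. ℕ, Partrec a ∧ (∀ f k n m, m ∈ a (initSeg f k, n) → m ∈ Φ f n) ∧
      ∀ f n m, m ∈ Φ f n → ∀ᶠ k in atTop, m ∈ a (initSeg f k, n) := by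
  induction hΦ with
  | zero => exact ⟨fun _ => Part.some 0, (Computable.const 0).partrec, by simp, by simp⟩
  | succ =>
    exact ⟨fun p => Part.some (p.2 + 1), (Computable.succ.comp .snd).partrec, by simp, by simp⟩
  | left =>
    exact ⟨fun p => Part.some p.2.unpair.1,
      (Computable.fst.comp (Computable.unpair.comp .snd)).partrec, by simp, by simp⟩
  | right =>
    exact ⟨fun p => Part.some p.2.unpair.2,
      (Computable.snd.comp (Computable.unpair.comp .snd)).partrec, by simp, by simp⟩
  | oracle =>
    refine ⟨fun p => p.1[p.2]?, (Computable.list_getElem?.comp .fst .snd).ofOption, ?_, ?_⟩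
    · intro f k n m h
      rw [Part.mem_coe, Option.mem_def] at h
      by_cases hn : n < k
      · rw [getElem?_initSeg hn] at h
        simpa using h.symm
      · rw [List.getElem?_eq_none (by rw [length_initSeg]; omega)] at h
        simp at h
    · intro f n m h
      filter_upwards [eventually_gt_atTop n] with k hk
      simpa [getElem?_initSeg hk] using h
  | @pair Φ Ψ _ _ h₁ h₂ =>
    obtain ⟨a, ha, hs, hc⟩ := h₁
    obtain ⟨b, hb, hs', hc'⟩ := h₂
    refine ⟨fun p => (a p).bind fun x => (b p).map fun y => Nat.pair x y,
      ha.bind ((hb.comp .fst).map (Primrec₂.natPair.to_comp.comp (Computable.snd.comp .fst) .snd)),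
      ?_, ?_⟩
    · intro f k n m h
      simp only [Part.mem_bind_iff, Part.mem_map_iff] at h ⊢
      obtain ⟨x, hx, y, hy, rfl⟩ := h
      exact ⟨x, hs _ _ _ _ hx, y, hs' _ _ _ _ hy, rfl⟩
    · intro f n m h
      simp only [Part.mem_bind_iff, Part.mem_map_iff] at h
      obtain ⟨x, hx, y, hy, rfl⟩ := h
      filter_upwards [hc _ _ _ hx, hc' _ _ _ hy] with k hx hy
      simp only [Part.mem_bind_iff, Part.mem_map_iff]
      exact ⟨x, hx, y, hy, rfl⟩
  | @comp Φ Ψ _ _ h₁ h₂ =>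
    obtain ⟨a, ha, hs, hc⟩ := h₁
    obtain ⟨b, hb, hs', hc'⟩ := h₂
    refine ⟨fun p => (b p).bind fun x => a (p.1, x),
      hb.bind (ha.comp (.pair (Computable.fst.comp .fst) .snd)), ?_, ?_⟩
    · intro f k n m h
      obtain ⟨x, hx, hm⟩ := Part.mem_bind_iff.1 h
      exact Part.mem_bind_iff.2 ⟨x, hs' _ _ _ _ hx, hs _ _ _ _ hm⟩
    · intro f n m h
      obtain ⟨x, hx, hm⟩ := Part.mem_bind_iff.1 h
      filter_upwards [hc' _ _ _ hx, hc _ _ _ hm] with k hx hm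
      exact Part.mem_bind_iff.2 ⟨x, hx, hm⟩
  | @prec Φ Ψ _ _ h₁ h₂ =>
    obtain ⟨a, ha, hs, hc⟩ := h₁
    obtain ⟨b, hb, hs', hc'⟩ := h₂
    refine ⟨fun p => Nat.rec (a (p.1, p.2.unpair.1)) (fun y IH => IH.bind fun i =>
      b (p.1, Nat.pair p.2.unpair.1 (Nat.pair y i))) p.2.unpair.2, ?_, ?_, ?_⟩
    · refine Partrec.nat_rec (f := fun p : List ℕ × ℕ => p.2.unpair.2)
        (g := fun p : List ℕ × ℕ => a (p.1, p.2.unpair.1))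
        (h := fun (p : List ℕ × ℕ) (q : ℕ × ℕ) =>
          b (p.1, Nat.pair p.2.unpair.1 (Nat.pair q.1 q.2))) ?_ ?_ ?_
      · exact Computable.snd.comp (Computable.unpair.comp .snd)
      · exact ha.comp (.pair .fst (Computable.fst.comp (Computable.unpair.comp .snd)))
      · refine hb.comp (.pair (Computable.fst.comp .fst) (Primrec₂.natPair.to_comp.comp
          (Computable.fst.comp (Computable.unpair.comp (Computable.snd.comp .fst)))
          (Primrec₂.natPair.to_comp.comp (Computable.fst.comp .snd) (Computable.snd.comp .snd))))
    · intro f k n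
      simp only
      generalize n.unpair.2 = y
      induction y with
      | zero => exact fun m => hs _ _ _ _
      | succ y ih =>
        intro m h
        obtain ⟨i, hi, hm⟩ := Part.mem_bind_iff.1 h
        exact Part.mem_bind_iff.2 ⟨i, ih _ hi, hs' _ _ _ _ hm⟩
    · intro f n
      simp only
      generalize n.unpair.2 = y
      induction y with
      | zero => exact fun m => hc _ _ _
      | succ y ih =>
        intro m h
        obtain ⟨i, hi, hm⟩ := Part.mem_bind_iff.1 h
        filter_upwards [ih _ hi, hc' _ _ _ hm] with k hi hm
        exact Part.mem_bind_iff.2 ⟨i, hi, hm⟩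
  | @rfind Φ _ h₁ =>
    obtain ⟨a, ha, hs, hc⟩ := h₁
    refine ⟨fun p => Nat.rfind fun n => (a (p.1, Nat.pair p.2 n)).map fun m => decide (m = 0),
      ?_, ?_, ?_⟩
    · have hz : Computable₂ fun (_ : (List ℕ × ℕ) × ℕ) (m : ℕ) => decide (m = 0) :=
        ((Primrec.eq (α := ℕ)).decide.comp .snd (.const 0)).to_comp
      exact Partrec.rfind ((ha.comp (.pair (Computable.fst.comp .fst)
        (Primrec₂.natPair.to_comp.comp (Computable.snd.comp .fst) .snd))).map hz)
    · intro f k n m h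
      obtain ⟨h0, h1⟩ := Nat.mem_rfind.1 h
      refine Nat.mem_rfind.2 ⟨?_, fun {j} hj => ?_⟩
      · obtain ⟨x, hx, he⟩ := (Part.mem_map_iff _).1 h0
        exact (Part.mem_map_iff _).2 ⟨x, hs _ _ _ _ hx, he⟩
      · obtain ⟨x, hx, he⟩ := (Part.mem_map_iff _).1 (h1 hj)
        exact (Part.mem_map_iff _).2 ⟨x, hs _ _ _ _ hx, he⟩
    · intro f n m h
      obtain ⟨h0, h1⟩ := Nat.mem_rfind.1 h
      have key : ∀ j b, b ∈ ((Φ f (Nat.pair n j)).map fun m => decide (m = 0)) →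
          ∀ᶠ k in atTop, b ∈ ((a (initSeg f k, Nat.pair n j)).map fun m => decide (m = 0)) := by
        intro j b hb
        obtain ⟨x, hx, he⟩ := (Part.mem_map_iff _).1 hb
        filter_upwards [hc _ _ _ hx] with k hx
        exact (Part.mem_map_iff _).2 ⟨x, hx, he⟩
      have h2 : ∀ᶠ k in atTop, ∀ j ∈ Set.Iio m,
          false ∈ ((a (initSeg f k, Nat.pair n j)).map fun m => decide (m = 0)) :=
        (eventually_all_finite (Set.finite_Iio m)).2 fun j hj => key j false (h1 hj)
      filter_upwards [key m true h0, h2] with k h0 h1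
      exact Nat.mem_rfind.2 ⟨h0, fun {j} hj => h1 j hj⟩

/-- There is a universal Turing functional. -/
theorem exists_universal : ∃ U, TuringFunctional U ∧ ∀ Φ, TuringFunctional Φ →
    ∃ e, ∀ f n, U f (Nat.pair e n) = Φ f n := by
  -- For p = (⟨e, n⟩, ⟨s, l⟩), code e is run with bound s on input n and the first l oracle values.
  -- The universal functional searches for ⟨s, l⟩ making this converge; soundness of the
  -- approximation makes the value independent of the pair found.
  let T : List ℕ → ℕ × ℕ → Option ℕ := fun σ p =>
    Nat.Partrec.Code.evaln p.2.unpair.1 (Denumerable.ofNat Nat.Partrec.Code p.1.unpair.1)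
      (encode (σ.take p.2.unpair.2, p.1.unpair.2))
  have hT : Primrec₂ T := by
    have h1 : Primrec fun q : List ℕ × ℕ × ℕ => q.2.1.unpair :=
      Primrec.unpair.comp (Primrec.fst.comp .snd)
    have h2 : Primrec fun q : List ℕ × ℕ × ℕ => q.2.2.unpair :=
      Primrec.unpair.comp (Primrec.snd.comp .snd)
    exact Nat.Partrec.Code.primrec_evaln.comp (.pair (.pair (Primrec.fst.comp h2)
      ((Primrec.ofNat _).comp (Primrec.fst.comp h1))) (Primrec.encode.comp
        (.pair (Primrec.list_take.comp (Primrec.snd.comp h2) .fst) (Primrec.snd.comp h1))))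
  have htake : ∀ f k l, l ≤ k → (initSeg f k).take l = initSeg f l := by
    intro f k l h
    simp [initSeg, ← List.map_take, List.take_range, h]
  have hO : OraclePrimrec fun f p => T (initSeg f p.2.unpair.2) p := by
    refine ⟨fun p => p.2.unpair.2, T, Primrec.snd.comp (Primrec.unpair.comp .snd), hT, ?_⟩
    intro f p k hk
    simp only [T]
    rw [htake f k _ hk, htake f _ _ le_rfl]
  have hP : OraclePrimrecPred fun f p => (T (initSeg f p.2.unpair.2) p).isSome = true :=
    (hO.map Primrec.option_isSome).eq_const true
  have hV : OraclePrimrec fun f (q : ℕ) =>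
      (T (initSeg f q.unpair.2.unpair.2) q.unpair).getD 0 :=
    (hO.comp Primrec.unpair).map (Primrec.option_getD.comp .id (.const 0))
  refine ⟨_, hV.turingFunctional.comp ((of_primrec .id).pair hP.rfind), fun Φ hΦ => ?_⟩
  obtain ⟨a, ha, hs, hc⟩ := hΦ.exists_approximation
  have ha' : Nat.Partrec fun s => a (Denumerable.ofNat (List ℕ × ℕ) s) :=
    Partrec.nat_iff.1 (ha.comp (Computable.ofNat _))
  obtain ⟨c, hcode⟩ := Nat.Partrec.Code.exists_code.1 ha'
  replace hcode : ∀ s, c.eval s = a (Denumerable.ofNat (List ℕ × ℕ) s) := congrFun hcode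
  have hTs : ∀ f n q m, m ∈ T (initSeg f q.unpair.2) (Nat.pair (encode c) n, q) → m ∈ Φ f n := by
    intro f n q m h
    simp only [T, Nat.unpair_pair, Denumerable.ofNat_encode, htake f _ _ le_rfl] at h
    have := Nat.Partrec.Code.evaln_sound h
    rw [hcode, Denumerable.ofNat_encode] at this
    exact hs _ _ _ _ this
  refine ⟨encode c, fun f n => Part.ext fun m => ⟨fun h => ?_, fun h => ?_⟩⟩
  · simp only [id, Part.bind_some, Part.mem_bind_iff, Part.mem_map_iff,
      Part.mem_some_iff] at h
    obtain ⟨_, ⟨q, hq, rfl⟩, rfl⟩ := h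
    have := Nat.rfind_spec hq
    simp only [Part.mem_some_iff, true_eq_decide_iff] at this
    obtain ⟨m, hm⟩ := Option.isSome_iff_exists.1 this
    simp only [Nat.unpair_pair, hm, Option.getD_some]
    exact hTs f n q m hm
  · obtain ⟨k, hk⟩ := (hc f n m h).exists
    have : m ∈ c.eval (encode (initSeg f k, n)) := by
      rw [hcode, Denumerable.ofNat_encode]
      exact hk
    obtain ⟨k', hk'⟩ := Nat.Partrec.Code.evaln_complete.1 this
    have hex : (T (initSeg f (Nat.pair k' k).unpair.2)
        (Nat.pair (encode c) n, Nat.pair k' k)).isSome = true := by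
      simp only [T, Nat.unpair_pair, Denumerable.ofNat_encode, htake f _ _ le_rfl]
      exact Option.isSome_iff_exists.2 ⟨m, hk'⟩
    obtain ⟨q, hq, -⟩ := Nat.rfind_min' (p := fun q =>
      decide ((T (initSeg f q.unpair.2) (Nat.pair (encode c) n, q)).isSome = true))
      (m := Nat.pair k' k) (by simpa using hex)
    have hq' := of_decide_eq_true (Part.mem_some_iff.1 (Nat.rfind_spec hq)).symm
    obtain ⟨m', hm'⟩ := Option.isSome_iff_exists.1 hq'
    obtain rfl : m' = m := Part.mem_unique (hTs f n q m' hm') h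
    exact Part.mem_bind_iff.2 ⟨_, Part.mem_bind_iff.2 ⟨_, Part.mem_some _,
      (Part.mem_map_iff _).2 ⟨q, by convert hq using 2; exact congrArg Nat.rfind (funext fun j => congrArg Part.some (by congr)), rfl⟩⟩, by simp [hm']⟩

end TuringFunctional

/-! ### Weihrauch reducibility and the compositional product -/

namespace TuringFunctional

theorem exists_maps_comp {Φ Ψ : (ℕ → ℕ) → ℕ →. ℕ} (hΦ : TuringFunctional Φ)
    (hΨ : TuringFunctional Ψ) :
    ∃ Θ, TuringFunctional Θ ∧ ∀ f g h, Maps Ψ f g → Maps Φ g h → Maps Θ f h := by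
  obtain ⟨Θ, hΘ, h⟩ := hΦ.exists_comp hΨ
  exact ⟨Θ, hΘ, fun f g k hg hk n => (congrFun (h f g hg) n).symm ▸ hk n⟩

/-- The functional `⟨f, g⟩ ↦ Ψ₁ ⟨f, Ψ₂ ⟨Φ f, g⟩⟩`. -/
theorem exists_backward {Φ Ψ₁ Ψ₂ : (ℕ → ℕ) → ℕ →. ℕ} (hΦ : TuringFunctional Φ)
    (hΨ₁ : TuringFunctional Ψ₁) (hΨ₂ : TuringFunctional Ψ₂) :
    ∃ Θ, TuringFunctional Θ ∧ ∀ f g p q r, Maps Φ f p → Maps Ψ₂ (join p g) q →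
      Maps Ψ₁ (join f q) r → Maps Θ (join f g) r := by
  obtain ⟨A, hA, A'⟩ := hΦ.exists_maps_comp oracle_left
  obtain ⟨B, hB, B'⟩ := hA.exists_join oracle_right
  obtain ⟨C, hC, C'⟩ := hΨ₂.exists_maps_comp hB
  obtain ⟨D, hD, D'⟩ := oracle_left.exists_join hC
  obtain ⟨E, hE, E'⟩ := hΨ₁.exists_maps_comp hD
  refine ⟨E, hE, fun f g p q r hp hq hr => ?_⟩
  exact E' _ _ _ (D' _ _ _ (maps_left f g) (C' _ _ _ (B' _ _ _ (A' _ _ _ (maps_left f g) hp)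
    (maps_right f g)) hq)) hr

end TuringFunctional

theorem WeihrauchLE.trans {F G H : Problem} (h₁ : F ≤ᵂ G) (h₂ : G ≤ᵂ H) : F ≤ᵂ H := by
  obtain ⟨Φ₁, Ψ₁, hΦ₁, hΨ₁, h₁⟩ := h₁
  obtain ⟨Φ₂, Ψ₂, hΦ₂, hΨ₂, h₂⟩ := h₂
  obtain ⟨Φ, hΦ, hΦ'⟩ := hΦ₂.exists_maps_comp hΦ₁
  obtain ⟨Ψ, hΨ, hΨ'⟩ := hΦ₁.exists_backward hΨ₁ hΨ₂
  refine ⟨Φ, Ψ, hΦ, hΨ, fun f hf => ?_⟩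
  obtain ⟨p, hp, hpG, h₁⟩ := h₁ f hf
  obtain ⟨q, hq, hqH, h₂⟩ := h₂ p hpG
  refine ⟨q, hΦ' _ _ _ hp hq, hqH, fun g hg => ?_⟩
  obtain ⟨k, hk, hkG⟩ := h₂ g hg
  obtain ⟨r, hr, hrF⟩ := h₁ k hkG
  exact ⟨r, hΨ' _ _ _ _ _ hp hk hr, hrF⟩

theorem WeihrauchLE.refl (F : Problem) : F ≤ᵂ F :=
  ⟨_, _, .oracle_id, .oracle_right, fun f hf => ⟨f, maps_oracle_id f, hf, fun g hg =>
    ⟨g, maps_right f g, hg⟩⟩⟩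

/-- The maximum is attained by a universal composition: `G₀` solves the `G`-instance on the right of
its input and passes the whole input on; `F₀` runs the program whose index stands at position 0 of
what it receives, and solves the resulting `F`-instance. Both keep their inputs, so the backward
functionals have all data. -/
theorem exists_isCompositionalProduct (F G : Problem) : ∃ P, IsCompositionalProduct F G P := by
  obtain ⟨U, hU, hU'⟩ := TuringFunctional.exists_universal
  let V : (ℕ → ℕ) → ℕ →. ℕ := fun z n => U z (Nat.pair (z 0) n)
  have hV : TuringFunctional V := by
    refine (hU.comp ((TuringFunctional.oracle.substPrimrec (Primrec.const 0)).pair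
      (.of_primrec .id))).of_eq fun z n => ?_
    simp only [Part.bind_some, Part.map_some, id]
    exact Part.bind_some _ (U z)
  let G₀ : Problem := fun t => {z | ∃ g ∈ G (right t), z = join t g}
  let F₀ : Problem := fun z => {r | ∃ w, Maps V z w ∧ ∃ h ∈ F w, r = join z h}
  have hF₀ : F₀ ≤ᵂ F := by
    refine ⟨_, _, hV, .oracle_id, ?_⟩
    rintro z ⟨r, w, hw, h, hh, rfl⟩
    exact ⟨w, hw, ⟨h, hh⟩, fun g hg => ⟨_, maps_oracle_id _, w, hw, g, hg, rfl⟩⟩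
  have hG₀ : G₀ ≤ᵂ G := by
    refine ⟨_, _, .oracle_right, .oracle_id, ?_⟩
    rintro t ⟨z, g, hg, rfl⟩
    exact ⟨right t, maps_some, ⟨g, hg⟩, fun g hg => ⟨_, maps_oracle_id _, g, hg, rfl⟩⟩
  refine ⟨F₀.comp G₀, ⟨F₀, G₀, hF₀, hG₀, .refl _, .refl _⟩, fun F' G' hF' hG' => ?_⟩
  obtain ⟨Φ₁, Ψ₁, hΦ₁, hΨ₁, h₁⟩ := hF'
  obtain ⟨Φ₂, Ψ₂, hΦ₂, hΨ₂, h₂⟩ := hG'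
  -- The intermediate data is z = ⟨⟨⟨e, x⟩, y⟩, g⟩, with x the original instance, y its `G`-instance
  -- and g a solution of y; this extracts x.
  have hA : TuringFunctional fun z n => Part.some (right (left (left z)) n) :=
    (OraclePrimrec.oracle (g := fun n : ℕ => 2 * (2 * (2 * n + 1))) (Primrec.nat_double.comp
      (Primrec.nat_double.comp Primrec.nat_double_succ))).turingFunctional
  obtain ⟨B, hB, hB'⟩ := hA.exists_join .oracle_right
  obtain ⟨C, hC, hC'⟩ := hΨ₂.exists_maps_comp hB
  have hC'' : ∀ e x y g k, Maps Ψ₂ (join x g) k → Maps C (join (join (join e x) y) g) k := by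
    intro e x y g k hk
    refine hC' _ _ _ (hB' _ x g ?_ (maps_right _ _)) hk
    simpa using maps_some (F := fun z => right (left (left z)))
        (f := join (join (join e x) y) g)
  obtain ⟨Θ, hΘ, hΘ'⟩ := hΦ₁.exists_maps_comp hC
  -- e is an index of the functional taking z to the `F`-instance: first `Ψ₂` on ⟨x, g⟩, then `Φ₁`.
  obtain ⟨e, he⟩ := hU' Θ hΘ
  obtain ⟨D, hD, hD'⟩ := (TuringFunctional.of_primrec (Primrec.const e)).exists_join .oracle_id
  obtain ⟨Φ, hΦ, hΦ'⟩ := hD.exists_join hΦ₂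
  obtain ⟨C₁, hC₁, hC₁'⟩ := hC.exists_maps_comp .oracle_left
  obtain ⟨C₂, hC₂, hC₂'⟩ := hC₁.exists_join .oracle_right
  obtain ⟨C₃, hC₃, hC₃'⟩ := hΨ₁.exists_maps_comp hC₂
  obtain ⟨Ψ, hΨ, hΨ'⟩ := hC₃.exists_maps_comp .oracle_right
  refine ⟨Φ, Ψ, hΦ, hΨ, ?_⟩
  rintro x ⟨-, hsub, k₀, hk₀, -⟩
  obtain ⟨y, hy, hyG, h₂⟩ := h₂ x ⟨k₀, hk₀⟩
  have key : ∀ g ∈ G y, ∃ k ∈ G' x, ∃ w,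
      Maps Ψ₂ (join x g) k ∧ Maps V (join (join (join (fun _ => e) x) y) g) w ∧
      w ∈ F.dom ∧ ∀ h ∈ F w, ∃ h', Maps Ψ₁ (join k h) h' ∧ h' ∈ F' k := by
    intro g hg
    obtain ⟨k, hk, hkG⟩ := h₂ g hg
    obtain ⟨w, hw, hwF, h₁⟩ := h₁ k (hsub hkG)
    refine ⟨k, hkG, w, hk, fun n => ?_, hwF, h₁⟩
    have := hΘ' _ _ _ (hC'' (fun _ => e) x y g k hk) hw n
    rw [← he] at this
    simpa [V, join] using this
  refine ⟨_, hΦ' _ _ _ (hD' x _ _ (fun n => Part.mem_some e) (maps_oracle_id x)) hy, ?_, ?_⟩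
  · obtain ⟨g, hg⟩ := hyG
    obtain ⟨k, hkG, w, -, hw, ⟨h, hh⟩, -⟩ := key g hg
    refine ⟨_, ?_, _, ⟨g, by simpa using hg, rfl⟩, w, hw, h, hh, rfl⟩
    rintro z ⟨g, hg, rfl⟩
    obtain ⟨k, hkG, w, -, hw, ⟨h, hh⟩, -⟩ := key g (by simpa using hg)
    exact ⟨_, w, hw, h, hh, rfl⟩
  · rintro r ⟨-, z, ⟨g, hg, rfl⟩, w', hw', h, hh, rfl⟩
    obtain ⟨k, hkG, w, hk, hw, -, h₃⟩ := key g (by simpa using hg)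
    obtain rfl := hw.unique hw'
    obtain ⟨h', hh', hF'⟩ := h₃ h hh
    exact ⟨h', hΨ' _ _ _ (maps_right _ _) (hC₃' _ _ _ (hC₂' _ _ _ (hC₁' _ _ _ (maps_left _ _)
      (hC'' _ _ _ _ _ hk)) (maps_right _ _)) hh'), hsub, k, hkG, hF'⟩

theorem isCompositionalProduct_compProd (F G : Problem) : IsCompositionalProduct F G (F ∗ G) :=
  Classical.epsilon_spec (exists_isCompositionalProduct F G)

theorem compProd_mono {F F' G G' : Problem} (hF : F ≤ᵂ F') (hG : G ≤ᵂ G') :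
    F ∗ G ≤ᵂ F' ∗ G' := by
  obtain ⟨⟨F₀, G₀, hF₀, hG₀, h, -⟩, -⟩ := isCompositionalProduct_compProd F G
  exact h.trans ((isCompositionalProduct_compProd F' G').2 F₀ G₀ (hF₀.trans hF) (hG₀.trans hG))

/-- A problem that can be solved by one application of `G` followed by one application of `F`
reduces to `F ∗ G`. -/
theorem le_compProd {A F G : Problem} {Φ₁ Φ₂ Ψ : (ℕ → ℕ) → ℕ →. ℕ} (hΦ₁ : TuringFunctional Φ₁)
    (hΦ₂ : TuringFunctional Φ₂) (hΨ : TuringFunctional Ψ)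
    (h : ∀ c ∈ A.dom, ∃ p, Maps Φ₁ c p ∧ p ∈ G.dom ∧ ∀ g ∈ G p, ∃ q, Maps Φ₂ (join c g) q ∧
      q ∈ F.dom ∧ ∀ b ∈ F q, ∃ r, Maps Ψ (join (join c g) b) r ∧ r ∈ A c) :
    A ≤ᵂ F ∗ G := by
  let G₀ : Problem := fun c => {z | c ∈ A.dom ∧ ∃ p, Maps Φ₁ c p ∧ ∃ g ∈ G p, z = join c g}
  let F₀ : Problem := fun z => {r | ∃ c ∈ A.dom, ∃ p g q b, z = join c g ∧ Maps Φ₁ c p ∧ g ∈ G p ∧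
    Maps Φ₂ z q ∧ b ∈ F q ∧ r = join z b}
  have hG₀ : G₀ ≤ᵂ G := by
    refine ⟨_, _, hΦ₁, .oracle_id, ?_⟩
    rintro c ⟨z, hc, p, hp, g, hg, rfl⟩
    exact ⟨p, hp, ⟨g, hg⟩, fun g hg => ⟨_, maps_oracle_id _, hc, p, hp, g, hg, rfl⟩⟩
  have hF₀ : F₀ ≤ᵂ F := by
    refine ⟨_, _, hΦ₂, .oracle_id, ?_⟩
    rintro z ⟨r, c, hc, p, g, q, b, rfl, hp, hg, hq, hb, rfl⟩
    exact ⟨q, hq, ⟨b, hb⟩, fun b hb =>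
      ⟨_, maps_oracle_id _, c, hc, p, g, q, b, rfl, hp, hg, hq, hb, rfl⟩⟩
  refine WeihrauchLE.trans ?_ ((isCompositionalProduct_compProd F G).2 F₀ G₀ hF₀ hG₀)
  obtain ⟨Ψ', hΨ', hΨ''⟩ := hΨ.exists_maps_comp .oracle_right
  refine ⟨_, _, .oracle_id, hΨ', fun c hc => ?_⟩
  obtain ⟨p, hp, hpG, h⟩ := h c hc
  have hsub : G₀ c ⊆ F₀.dom := by
    rintro z ⟨-, p', hp', g, hg, rfl⟩
    obtain rfl := hp.unique hp'
    obtain ⟨q, hq, ⟨b, hb⟩, -⟩ := h g hg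
    exact ⟨_, c, hc, p, g, q, b, rfl, hp, hg, hq, hb, rfl⟩
  refine ⟨c, maps_oracle_id c, ?_, ?_⟩
  · obtain ⟨g, hg⟩ := hpG
    have hz : join c g ∈ G₀ c := ⟨hc, p, hp, g, hg, rfl⟩
    obtain ⟨r, hr⟩ := hsub hz
    exact ⟨r, hsub, _, hz, hr⟩
  · rintro r ⟨-, z, ⟨-, p', hp', g, hg, rfl⟩, -, -, -, -, q', b, -, -, -, hq', hb, rfl⟩
    obtain rfl := hp.unique hp'
    obtain ⟨q, hq, -, h⟩ := h g hg
    obtain rfl := hq.unique hq'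
    obtain ⟨r, hr, hrA⟩ := h b hb
    exact ⟨r, hΨ'' _ _ _ (maps_right _ _) hr, hrA⟩

/-! ### Coded graphs and computable thinning -/

theorem charFn_eq_one_iff {A : Set ℕ} {n : ℕ} : charFn A n = 1 ↔ n ∈ A := by
  by_cases h : n ∈ A <;> simp [charFn, h]

theorem charFn_injective : Function.Injective charFn := fun A B h => by
  ext n
  rw [← charFn_eq_one_iff, h, charFn_eq_one_iff]

@[simp] theorem setOf_charFn_eq_one (A : Set ℕ) : {n | charFn A n = 1} = A := by
  ext n
  exact charFn_eq_one_iff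

namespace OraclePrimrec

theorem id : OraclePrimrec fun f (n : ℕ) => f n := .oracle .id

theorem left {G : (ℕ → ℕ) → ℕ → ℕ} (hG : OraclePrimrec G) :
    OraclePrimrec fun f n => left (G f) n :=
  hG.comp Primrec.nat_double

theorem right {G : (ℕ → ℕ) → ℕ → ℕ} (hG : OraclePrimrec G) :
    OraclePrimrec fun f n => right (G f) n :=
  hG.comp Primrec.nat_double_succ

end OraclePrimrec

theorem Graph.code_injective : Function.Injective Graph.code := fun G G' h => by
  obtain ⟨h₁, h₂⟩ := join_inj.1 h
  have key : ∀ x y, x < y → (G.Adj x y ↔ G'.Adj x y) := fun x y hxy => by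
    have := Set.ext_iff.1 (charFn_injective h₂) (Nat.pair x y)
    simpa [hxy] using this
  refine SimpleGraph.Subgraph.ext (charFn_injective h₁) (funext₂ fun x y => propext ?_)
  rcases lt_trichotomy x y with hxy | rfl | hxy
  · exact key x y hxy
  · exact ⟨fun h => (h.ne rfl).elim, fun h => (h.ne rfl).elim⟩
  · rw [G.adj_comm, G'.adj_comm, key y x hxy]

/-- The symmetric relation determined by the restriction of `R` to pairs `x < y`. -/
def symmRel (R : ℕ → ℕ → Prop) (x y : ℕ) : Prop := (x < y ∧ R x y) ∨ (y < x ∧ R y x)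

theorem symmRel_comm {R : ℕ → ℕ → Prop} {x y : ℕ} : symmRel R x y ↔ symmRel R y x := Or.comm

/-- The graph on `K` in which `x < y` are adjacent if and only if `R x y`. -/
def relGraph (K : Set ℕ) (R : ℕ → ℕ → Prop) : Graph where
  verts := K
  Adj x y := x ∈ K ∧ y ∈ K ∧ symmRel R x y
  adj_sub := by
    rintro x y ⟨-, -, h | h⟩
    exacts [h.1.ne, h.1.ne']
  edge_vert h := h.1
  symm := ⟨fun _ _ h => ⟨h.2.1, h.1, symmRel_comm.1 h.2.2⟩⟩

section Computability

variable {K : (ℕ → ℕ) → Set ℕ} {R : (ℕ → ℕ) → ℕ → ℕ → Prop}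

theorem OraclePrimrecPred.symmRel (hR : OraclePrimrecPred fun f (p : ℕ × ℕ) => R f p.1 p.2) :
    OraclePrimrecPred fun f (p : ℕ × ℕ) => symmRel (R f) p.1 p.2 := by
  have h : OraclePrimrecPred fun f (p : ℕ × ℕ) => p.1 < p.2 ∧ R f p.1 p.2 :=
    (Primrec.nat_lt.comp .fst .snd).oraclePrimrecPred.and hR
  exact h.or (h.comp (Primrec.pair .snd .fst))

open Classical in
theorem TuringFunctional.relGraph_code (hK : OraclePrimrecPred fun f n => n ∈ K f)
    (hR : OraclePrimrecPred fun f (p : ℕ × ℕ) => R f p.1 p.2) :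
    TuringFunctional fun f n => Part.some ((relGraph (K f) (R f)).code n) := by
  have hdiv : Primrec fun n : ℕ => n / 2 := Primrec.nat_div.comp .id (.const 2)
  have hmod : PrimrecPred fun n : ℕ => n % 2 = 0 :=
    Primrec.eq.comp (Primrec.nat_mod.comp .id (.const 2)) (.const 0)
  have hE : OraclePrimrecPred fun f (n : ℕ) => n.unpair.1 < n.unpair.2 ∧
      n.unpair.1 ∈ K f ∧ n.unpair.2 ∈ K f ∧ R f n.unpair.1 n.unpair.2 :=
    (Primrec.nat_lt.comp (Primrec.fst.comp .unpair)
      (Primrec.snd.comp .unpair)).oraclePrimrecPred.and ((hK.comp (Primrec.fst.comp .unpair)).and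
        ((hK.comp (Primrec.snd.comp .unpair)).and (hR.comp .unpair)))
  have h1 := (Primrec.const (α := ℕ) 1).oraclePrimrec
  have h0 := (Primrec.const (α := ℕ) 0).oraclePrimrec
  refine (hmod.oraclePrimrecPred.ite ((hK.comp hdiv).ite h1 h0)
    ((hE.comp hdiv).ite h1 h0)).turingFunctional.of_eq fun f n => ?_
  have key : ∀ x y, (x < y ∧ x ∈ K f ∧ y ∈ K f ∧ R f x y) ↔
      (x < y ∧ x ∈ K f ∧ y ∈ K f ∧ Weihrauch.symmRel (R f) x y) := fun x y =>
    and_congr_right fun h => by simp [Weihrauch.symmRel, h, h.not_gt]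
  simp only [Graph.code, join, charFn, Set.indicator_apply, relGraph, Set.mem_ofPred_eq, key]

/-- `w` codes a vertex together with two of its neighbours, all of them in `H`. -/
def IsTwoNeighbors (H : Set ℕ) (R : ℕ → ℕ → Prop) (w : ℕ) : Prop :=
  w.unpair.1 ∈ H ∧ w.unpair.2.unpair.1 ∈ H ∧ w.unpair.2.unpair.2 ∈ H ∧
    w.unpair.2.unpair.1 ≠ w.unpair.2.unpair.2 ∧
    symmRel R w.unpair.1 w.unpair.2.unpair.1 ∧ symmRel R w.unpair.1 w.unpair.2.unpair.2

theorem OraclePrimrecPred.isTwoNeighbors (hK : OraclePrimrecPred fun f n => n ∈ K f)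
    (hR : OraclePrimrecPred fun f (p : ℕ × ℕ) => R f p.1 p.2) :
    OraclePrimrecPred fun f w => IsTwoNeighbors (K f) (R f) w := by
  have h₁ : Primrec fun w : ℕ => w.unpair.1 := Primrec.fst.comp .unpair
  have h₂ : Primrec fun w : ℕ => w.unpair.2 := Primrec.snd.comp .unpair
  have h₃ := h₁.comp h₂
  have h₄ := h₂.comp h₂
  exact (hK.comp h₁).and ((hK.comp h₃).and ((hK.comp h₄).and
    ((Primrec.eq.comp h₃ h₄).not.oraclePrimrecPred.and
      ((hR.symmRel.comp (Primrec.pair h₁ h₃)).and (hR.symmRel.comp (Primrec.pair h₁ h₄))))))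

/-- An infinite set of codes `w` for numbers `w.unpair.1` can be thinned out to a set all whose
pairs satisfy a relation that is satisfied in the limit. -/
theorem exists_thinning {E : (ℕ → ℕ) → ℕ → Prop} {Q : (ℕ → ℕ) → ℕ × ℕ → Prop}
    (hE : OraclePrimrecPred E) (hQ : OraclePrimrecPred Q) :
    ∃ Ψ, TuringFunctional Ψ ∧ ∀ (f : ℕ → ℕ) (S : Set ℕ),
      (∀ x, x ∈ S ↔ ∃ w, E f w ∧ w.unpair.1 = x) → S.Infinite →
      (∀ x ∈ S, ∀ᶠ s in atTop, s ∈ S → Q f (x, s)) →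
      ∃ H ⊆ S, H.Infinite ∧ (∀ x ∈ H, ∀ y ∈ H, x < y → Q f (x, y)) ∧ Maps Ψ f (charFn H) := by
  have hfst : Primrec fun p : ℕ × List ℕ × ℕ => p.1.unpair.1 :=
    Primrec.fst.comp (Primrec.unpair.comp .fst)
  have hsnd : Primrec fun p : ℕ × List ℕ × ℕ => p.2.2.unpair.1 :=
    Primrec.fst.comp (Primrec.unpair.comp (Primrec.snd.comp .snd))
  have h₁ : OraclePrimrecPred fun f (p : ℕ × List ℕ × ℕ) =>
      p.1.unpair.1 < p.2.2.unpair.1 ∧ Q f (p.1.unpair.1, p.2.2.unpair.1) :=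
    (Primrec.nat_lt.comp hfst hsnd).oraclePrimrecPred.and (hQ.comp (Primrec.pair hfst hsnd))
  obtain ⟨Ψ, hΨ, h⟩ := exists_greedy ((hE.comp Primrec.snd).and (h₁.forall_mem Primrec.fst))
  refine ⟨Ψ, hΨ, fun f S hS hinf hlim => ?_⟩
  have hex : ∀ σ : List ℕ, (∀ x ∈ σ, E f x) → ∃ w, E f w ∧ ∀ x ∈ σ,
      x.unpair.1 < w.unpair.1 ∧ Q f (x.unpair.1, w.unpair.1) := by
    intro σ hσ
    -- Finitely many limit conditions hold simultaneously from some point on, and `S` is unbounded.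
    have : ∀ᶠ s in atTop, ∀ x ∈ {x | x ∈ σ}, x.unpair.1 < s ∧ (s ∈ S → Q f (x.unpair.1, s)) :=
      (eventually_all_finite σ.finite_toSet).2 fun x hx =>
        (eventually_gt_atTop _).and (hlim _ ((hS _).2 ⟨x, hσ x hx, rfl⟩))
    obtain ⟨s, hs, hsS⟩ := (this.and_frequently (Nat.frequently_atTop_iff_infinite.2 hinf)).exists
    obtain ⟨w, hw, rfl⟩ := (hS s).1 hsS
    exact ⟨w, hw, fun x hx => ⟨(hs x hx).1, (hs x hx).2 hsS⟩⟩
  obtain ⟨w, hw, hmaps⟩ := h f (fun σ => ∀ x ∈ σ, E f x) (by simp) hex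
    (fun σ w hσ hw x hx => (List.mem_cons.1 hx).elim (fun h => h ▸ hw.1) (hσ x))
    (fun σ w hw x hx => (hw.2 x hx).1)
  have hmono : StrictMono fun n => (w n).unpair.1 := strictMono_nat_of_lt_succ fun n =>
    ((hw (n + 1)).2.2 _ (mem_history.2 ⟨n, n.lt_succ_self, rfl⟩)).1
  refine ⟨_, ?_, Set.infinite_range_of_injective hmono.injective, ?_, hmaps⟩
  · rintro _ ⟨n, rfl⟩
    exact (hS _).2 ⟨w n, (hw n).2.1, rfl⟩
  · rintro _ ⟨m, rfl⟩ _ ⟨n, rfl⟩ hmn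
    exact ((hw n).2.2 _ (mem_history.2 ⟨m, hmono.lt_iff_lt.1 hmn, rfl⟩)).2

end Computability

/-- Every vertex of `H` has infinitely many or at most one neighbour in `H`. -/
def IsWeakRS (G : Graph) (H : Set ℕ) : Prop :=
  ∀ v ∈ H, (H ∩ G.neighborSet v).Infinite ∨ (H ∩ G.neighborSet v).encard ≤ 1

/-- Every vertex of `H` has infinitely many or no neighbours in `H`. -/
def IsWeakRSr (G : Graph) (H : Set ℕ) : Prop :=
  ∀ v ∈ H, (H ∩ G.neighborSet v).Infinite ∨ H ∩ G.neighborSet v = ∅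

theorem mem_wRSg_code {G : Graph} {h : ℕ → ℕ} : h ∈ wRSg G.code ↔ G.verts.Infinite ∧
    ∃ H : Set ℕ, H ⊆ G.verts ∧ H.Infinite ∧ IsWeakRS G H ∧ h = charFn H := by
  constructor
  · rintro ⟨G', hG', h⟩
    rwa [Graph.code_injective hG']
  · exact fun h => ⟨G, rfl, h⟩

theorem mem_wRSgr_code {G : Graph} {h : ℕ → ℕ} : h ∈ wRSgr G.code ↔ G.verts.Infinite ∧
    ∃ H : Set ℕ, H ⊆ G.verts ∧ H.Infinite ∧ IsWeakRSr G H ∧ h = charFn H := by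
  constructor
  · rintro ⟨G', hG', h⟩
    rwa [Graph.code_injective hG']
  · exact fun h => ⟨G, rfl, h⟩

theorem mem_neighborSet_relGraph {K H : Set ℕ} {R : ℕ → ℕ → Prop} (hH : H ⊆ K) {x y : ℕ}
    (hx : x ∈ H) : y ∈ H ∩ (relGraph K R).neighborSet x ↔ y ∈ H ∧ symmRel R x y :=
  ⟨fun h => ⟨h.1, h.2.2.2⟩, fun h => ⟨h.1, hH hx, hH h.1, h.2⟩⟩

/-- A solution allows no finite number of neighbours above one, so two neighbours are a finite
certificate for infinitely many. -/
theorem IsWeakRS.exists_isTwoNeighbors_iff {K H : Set ℕ} {R : ℕ → ℕ → Prop}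
    (h : IsWeakRS (relGraph K R) H) (hH : H ⊆ K) {x : ℕ} :
    (∃ w, IsTwoNeighbors H R w ∧ w.unpair.1 = x) ↔
      x ∈ H ∧ (H ∩ (relGraph K R).neighborSet x).Infinite := by
  constructor
  · rintro ⟨w, ⟨hx, ha, hb, hab, hxa, hxb⟩, rfl⟩
    refine ⟨hx, (h _ hx).resolve_right (not_le.2 (Set.one_lt_encard_iff.2 ⟨_, _, ?_, ?_, hab⟩))⟩
    · exact (mem_neighborSet_relGraph hH hx).2 ⟨ha, hxa⟩
    · exact (mem_neighborSet_relGraph hH hx).2 ⟨hb, hxb⟩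
  · rintro ⟨hx, hinf⟩
    have : 1 < (H ∩ (relGraph K R).neighborSet x).encard := by
      rw [hinf.encard_eq]; exact ENat.one_lt_top
    obtain ⟨a, b, ha, hb, hab⟩ := Set.one_lt_encard_iff.1 this
    rw [mem_neighborSet_relGraph hH hx] at ha hb
    exact ⟨Nat.pair x (Nat.pair a b), by simp [IsTwoNeighbors, *], by simp⟩

/-! ### Stable colourings -/

/-- `lim_s c(x, s)` exists for every `x ∈ K`, as `s` ranges over `K`. -/
def IsStableOn (c : ℕ → ℕ) (K : Set ℕ) : Prop :=
  ∀ x ∈ K, ∃ i, ∀ᶠ s in atTop, s ∈ K → c (Nat.pair x s) = i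

/-- Stable Ramsey's theorem for pairs and two colours, for colourings that are stable on a given
set. -/
def SRTPairsOn : Problem :=
  fun p => {h | ∃ c K, p = join c (charFn K) ∧ IsColoring c ∧ IsStableOn c K ∧
    ∃ H ⊆ K, H.Infinite ∧ IsHomogeneous c H ∧ h = charFn H}

theorem SRTPairs_le_SRTPairsOn : SRTPairs ≤ᵂ SRTPairsOn := by
  obtain ⟨Φ, hΦ, hΦ'⟩ := TuringFunctional.oracle_id.exists_join (.of_primrec (Primrec.const 1))
  refine ⟨Φ, _, hΦ, .oracle_right, ?_⟩
  rintro c ⟨h, hc, hs, H, hinf, hH, rfl⟩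
  have h1 : charFn Set.univ = fun _ => 1 := by ext; simp [charFn]
  refine ⟨join c (charFn Set.univ), h1 ▸ hΦ' c c (fun _ => 1) (maps_oracle_id c)
    (fun _ => Part.mem_some 1), ?_, ?_⟩
  · exact ⟨_, c, Set.univ, rfl, hc, fun x _ => by simpa using hs x, H, H.subset_univ, hinf, hH, rfl⟩
  · rintro g ⟨c', K, hj, hc', -, H', -, hinf', hH', rfl⟩
    obtain ⟨rfl, -⟩ := join_inj.1 hj
    exact ⟨_, maps_right _ _, hc, hs, H', hinf', hH', rfl⟩

/-- The graph on `K` whose edges are the pairs of colour `1`. -/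
def colorGraph (c : ℕ → ℕ) (K : Set ℕ) : Graph := relGraph K fun x y => c (Nat.pair x y) = 1

section Combinatorics

variable {c : ℕ → ℕ} {K H : Set ℕ} {x : ℕ}

theorem eventually_eq_one (hs : IsStableOn c K) (hH : H ⊆ K) (hx : x ∈ H)
    (h : (H ∩ (colorGraph c K).neighborSet x).Infinite) :
    ∀ᶠ s in atTop, s ∈ H → c (Nat.pair x s) = 1 := by
  obtain ⟨i, hi⟩ := hs x (hH hx)
  have hfr := Nat.frequently_atTop_iff_infinite.2 h
  obtain ⟨s, ⟨hsi, hxs⟩, hsH⟩ := ((hi.and (eventually_gt_atTop x)).and_frequently hfr).exists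
  have h1 : c (Nat.pair x s) = 1 :=
    (((mem_neighborSet_relGraph hH hx).1 hsH).2.resolve_right fun h => h.1.not_gt hxs).2
  obtain rfl : i = 1 := by rw [← hsi (hH hsH.1), h1]
  exact hi.mono fun s hs hsH => hs (hH hsH)

theorem eventually_eq_zero (hc : IsColoring c) (hH : H ⊆ K) (hx : x ∈ H)
    (h : ¬ (H ∩ (colorGraph c K).neighborSet x).Infinite) :
    ∀ᶠ s in atTop, s ∈ H → c (Nat.pair x s) = 0 := by
  have hev : ∀ᶠ s in atTop, s ∉ H ∩ (colorGraph c K).neighborSet x := by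
    exact not_frequently.1 fun hf => h (Nat.frequently_atTop_iff_infinite.1 hf)
  filter_upwards [hev, eventually_gt_atTop x] with s hs hxs hsH
  refine (hc x s hxs).resolve_right fun h1 => hs ?_
  exact (mem_neighborSet_relGraph hH hx).2 ⟨hsH, Or.inl ⟨hxs, h1⟩⟩

/-- Used to see that the colour graph lies in the domain: on a homogeneous set it is complete or
empty. -/
theorem IsHomogeneous.isWeakRSr (h : IsHomogeneous c H) (hinf : H.Infinite) (hH : H ⊆ K) :
    IsWeakRSr (colorGraph c K) H := by
  obtain ⟨i, hi⟩ := h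
  intro x hx
  by_cases h1 : i = 1
  · subst h1
    refine Or.inl (Nat.frequently_atTop_iff_infinite.1 ?_)
    refine ((Nat.frequently_atTop_iff_infinite.2 hinf).and_eventually
      (eventually_gt_atTop x)).mono fun s hs => ?_
    exact (mem_neighborSet_relGraph hH hx).2 ⟨hs.1, Or.inl ⟨hs.2, hi x hx s hs.1 hs.2⟩⟩
  · refine Or.inr (Set.eq_empty_of_forall_notMem fun s hs => ?_)
    obtain ⟨hsH, h | h⟩ := (mem_neighborSet_relGraph hH hx).1 hs
    · exact h1 ((hi x hx s hsH h.1).symm.trans h.2)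
    · exact h1 ((hi s hsH x hx h.1).symm.trans h.2)

theorem IsWeakRSr.isWeakRS {G : Graph} (h : IsWeakRSr G H) : IsWeakRS G H := fun v hv =>
  (h v hv).imp_right fun h => by simp [h]

end Combinatorics

theorem turingFunctional_colorGraph_code : TuringFunctional fun f n =>
    Part.some ((colorGraph (left f) {x | right f x = 1}).code n) :=
  .relGraph_code (OraclePrimrec.id.right.eq_const 1)
    ((OraclePrimrec.id.left.comp Primrec₂.natPair).eq_const 1)

/-- `LPO` is asked whether H spans an edge. The bit b = 0 means yes, and then the vertices having a
neighbour in H are enumerated; in both cases the common limit colour is 1 - b. -/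
theorem SRTPairsOn_le_LPO_wRSgr : SRTPairsOn ≤ᵂ LPO ∗ wRSgr := by
  classical
  have hc₂ : OraclePrimrec fun f n => left (left f) n := OraclePrimrec.id.left.left
  have hh₂ : OraclePrimrec fun f n => right f n := OraclePrimrec.id.right
  have hP : OraclePrimrecPred fun f (n : ℕ) => n.unpair.1 < n.unpair.2 ∧
      right f n.unpair.1 = 1 ∧ right f n.unpair.2 = 1 ∧ left (left f) n = 1 :=
    (Primrec.nat_lt.comp (Primrec.fst.comp .unpair)
      (Primrec.snd.comp .unpair)).oraclePrimrecPred.and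
      (((hh₂.comp (Primrec.fst.comp .unpair)).eq_const 1).and
        (((hh₂.comp (Primrec.snd.comp .unpair)).eq_const 1).and (hc₂.eq_const 1)))
  have hΦ := (hP.ite (Primrec.const (α := ℕ) 0).oraclePrimrec
    (Primrec.const (α := ℕ) 1).oraclePrimrec).turingFunctional
  have hc₃ : OraclePrimrec fun f n => left (left (left f)) n := OraclePrimrec.id.left.left.left
  have hh₃ : OraclePrimrec fun f n => right (left f) n := OraclePrimrec.id.left.right
  have hR : OraclePrimrecPred fun f (p : ℕ × ℕ) => left (left (left f)) (Nat.pair p.1 p.2) = 1 :=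
    (hc₃.comp Primrec₂.natPair).eq_const 1
  -- The oracle is ⟨⟨⟨c, K⟩, H⟩, b⟩, so its value at 1 is the bit; w pairs a vertex with a
  -- neighbour.
  have hE : OraclePrimrecPred fun f (w : ℕ) => right (left f) w.unpair.1 = 1 ∧
      (f 1 = 0 → right (left f) w.unpair.2 = 1 ∧
        symmRel (fun x y => left (left (left f)) (Nat.pair x y) = 1) w.unpair.1 w.unpair.2) :=
    ((hh₃.comp (Primrec.fst.comp .unpair)).eq_const 1).and
      (((OraclePrimrec.oracle (.const 1)).eq_const 0).imp
        (((hh₃.comp (Primrec.snd.comp .unpair)).eq_const 1).and (hR.symmRel.comp .unpair)))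
  have hQ : OraclePrimrecPred fun f (p : ℕ × ℕ) =>
      left (left (left f)) (Nat.pair p.1 p.2) = 1 - f 1 :=
    (hc₃.comp Primrec₂.natPair).eq
      ((OraclePrimrec.oracle (.const 1)).map (Primrec.nat_sub.comp (.const 1) .id))
  obtain ⟨Ψ, hΨ, hΨ'⟩ := exists_thinning hE hQ
  refine le_compProd turingFunctional_colorGraph_code hΦ hΨ ?_
  rintro _ ⟨_, c, K, rfl, hc, hs, H₀, hH₀, hinf₀, hom₀, rfl⟩
  refine ⟨_, maps_some, ?_, ?_⟩
  · simp only [left_join, right_join, setOf_charFn_eq_one]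
    exact ⟨_, mem_wRSgr_code.2 ⟨hinf₀.mono hH₀, H₀, hH₀, hinf₀, hom₀.isWeakRSr hinf₀ hH₀, rfl⟩⟩
  simp only [left_join, right_join, setOf_charFn_eq_one, mem_wRSgr_code]
  rintro _ ⟨-, H, hH, hinf, hRS, rfl⟩
  refine ⟨_, maps_some, ⟨_, rfl⟩, ?_⟩
  rintro _ rfl
  simp only [left_join, right_join, charFn_eq_one_iff]
  set b : ℕ := if ∃ n, (if n.unpair.1 < n.unpair.2 ∧ n.unpair.1 ∈ H ∧ n.unpair.2 ∈ H ∧ c n = 1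
    then 0 else 1) = 0 then 0 else 1 with hb
  have hb0 : b = 0 ↔ ∃ x ∈ H, ∃ y ∈ H, symmRel (fun x y => c (Nat.pair x y) = 1) x y := by
    have : b = 0 ↔ ∃ n : ℕ, n.unpair.1 < n.unpair.2 ∧ n.unpair.1 ∈ H ∧ n.unpair.2 ∈ H ∧ c n = 1 := by
      simp [hb]
    rw [this]
    constructor
    · rintro ⟨n, h1, h2, h3, h4⟩
      exact ⟨_, h2, _, h3, Or.inl ⟨h1, by simpa using h4⟩⟩
    · rintro ⟨x, hx, y, hy, h | h⟩
      · exact ⟨Nat.pair x y, by simpa [hx, hy] using h⟩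
      · exact ⟨Nat.pair y x, by simpa [hx, hy] using h⟩
  have hb01 : b = 0 ∨ b = 1 := by
    rw [hb]; split_ifs <;> simp
  clear_value b
  set S : Set ℕ := {x ∈ H | b = 0 → ∃ y ∈ H, symmRel (fun x y => c (Nat.pair x y) = 1) x y} with hS
  have hinfS : S.Infinite := by
    by_cases h0 : b = 0
    · obtain ⟨x, hx, y, hy, hxy⟩ := hb0.1 h0
      -- A single edge at x forces infinitely many, and each neighbour of x has x as its own
      -- neighbour.
      refine ((hRS x hx).resolve_right (Set.nonempty_iff_ne_empty.1
        ⟨y, (mem_neighborSet_relGraph hH hx).2 ⟨hy, hxy⟩⟩)).mono fun z hz => ?_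
      obtain ⟨hz, hxz⟩ := (mem_neighborSet_relGraph hH hx).1 hz
      exact ⟨hz, fun _ => ⟨x, hx, symmRel_comm.1 hxz⟩⟩
    · exact hinf.mono fun x hx => ⟨hx, fun h => absurd h h0⟩
  have hlim : ∀ x ∈ S, ∀ᶠ s in atTop, s ∈ S → c (Nat.pair x s) = 1 - b := by
    rintro x ⟨hx, hxS⟩
    rcases hb01 with h0 | h1
    · obtain ⟨y, hy, hxy⟩ := hxS h0
      have := eventually_eq_one hs hH hx ((hRS x hx).resolve_right (Set.nonempty_iff_ne_empty.1
        ⟨y, (mem_neighborSet_relGraph hH hx).2 ⟨hy, hxy⟩⟩))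
      exact this.mono fun s hs hsS => by rw [hs hsS.1, h0]
    · have : ¬ (H ∩ (colorGraph c K).neighborSet x).Infinite := fun hx' => by
        obtain ⟨y, hy⟩ := hx'.nonempty
        obtain ⟨hy, hxy⟩ := (mem_neighborSet_relGraph hH hx).1 hy
        have := hb0.2 ⟨x, hx, y, hy, hxy⟩
        omega
      exact (eventually_eq_zero hc hH hx this).mono fun s hs hsS => by rw [hs hsS.1, h1]
  have hiff : ∀ x, x ∈ S ↔ ∃ w : ℕ, (w.unpair.1 ∈ H ∧ (b = 0 → w.unpair.2 ∈ H ∧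
      symmRel (fun x y => c (Nat.pair x y) = 1) w.unpair.1 w.unpair.2)) ∧ w.unpair.1 = x := by
    refine fun x => ⟨fun ⟨hx, hxS⟩ => ?_, ?_⟩
    · by_cases h0 : b = 0
      · obtain ⟨y, hy, hxy⟩ := hxS h0
        exact ⟨Nat.pair x y, by simp [hx, hy, hxy], by simp⟩
      · exact ⟨Nat.pair x 0, by simp [hx, h0], by simp⟩
    · rintro ⟨w, ⟨hw, hw'⟩, rfl⟩
      exact ⟨hw, fun h0 => ⟨_, hw' h0⟩⟩
  obtain ⟨H', hH'S, hinf', hhom, hmaps⟩ := hΨ' (join (join (join c (charFn K)) (charFn H))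
    fun _ => b) S (by simpa [join, charFn_eq_one_iff] using hiff) hinfS
    (by simpa [join] using hlim)
  refine ⟨_, hmaps, c, K, rfl, hc, hs, H', fun x hx => hH (hH'S hx).1, hinf', ⟨1 - b, ?_⟩, rfl⟩
  simpa [join] using hhom

/-- With B the set of vertices having two neighbours in H, thin out B if it has two elements, and H
without B otherwise. When B has at most one element, the bit on nonemptiness makes this complement
computable. -/
theorem SRTPairsOn_le_LPO_prod_LPO_wRSg : SRTPairsOn ≤ᵂ (LPO.prod LPO) ∗ wRSg := by
  classical
  have hu₁ : Primrec fun n : ℕ => n.unpair.1 := Primrec.fst.comp .unpair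
  have hu₂ : Primrec fun n : ℕ => n.unpair.2 := Primrec.snd.comp .unpair
  have h1 := (Primrec.const (α := ℕ) 1).oraclePrimrec
  have h0 := (Primrec.const (α := ℕ) 0).oraclePrimrec
  have hT₂ : OraclePrimrecPred fun f w =>
      IsTwoNeighbors {x | right f x = 1} (fun x y => left (left f) (Nat.pair x y) = 1) w :=
    .isTwoNeighbors (OraclePrimrec.id.right.eq_const 1)
      ((OraclePrimrec.id.left.left.comp Primrec₂.natPair).eq_const 1)
  -- The first instance has a zero iff some vertex is certified to lie in B, the second iff two
  -- distinct vertices are.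
  obtain ⟨Φ, hΦ, hΦ'⟩ := (hT₂.ite h0 h1).turingFunctional.exists_join
    (((hT₂.comp hu₁).and ((hT₂.comp hu₂).and
      (Primrec.eq.comp (hu₁.comp hu₁) (hu₁.comp hu₂)).not.oraclePrimrecPred)).ite
      h0 h1).turingFunctional
  have hT₃ : OraclePrimrecPred fun f w => IsTwoNeighbors {x | right (left f) x = 1}
      (fun x y => left (left (left f)) (Nat.pair x y) = 1) w :=
    .isTwoNeighbors (OraclePrimrec.id.left.right.eq_const 1)
      ((OraclePrimrec.id.left.left.left.comp Primrec₂.natPair).eq_const 1)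
  have hb₁ : OraclePrimrecPred fun f (_ : ℕ) => f 1 = 0 :=
    (OraclePrimrec.oracle (.const 1)).eq_const 0
  have hb₂ : OraclePrimrecPred fun f (_ : ℕ) => f 3 = 0 :=
    (OraclePrimrec.oracle (.const 3)).eq_const 0
  -- The bits stand at positions 1 and 3. If B has two elements, w is itself a certificate for its
  -- vertex; if B is a singleton, w pairs a vertex with a certificate for a different vertex, which
  -- must be the exceptional one.
  have hE : OraclePrimrecPred fun f w => right (left f) w.unpair.1 = 1 ∧
      (f 3 = 0 → IsTwoNeighbors {x | right (left f) x = 1}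
        (fun x y => left (left (left f)) (Nat.pair x y) = 1) w) ∧
      (¬ f 3 = 0 → f 1 = 0 → IsTwoNeighbors {x | right (left f) x = 1}
        (fun x y => left (left (left f)) (Nat.pair x y) = 1) w.unpair.2 ∧
        ¬ w.unpair.2.unpair.1 = w.unpair.1) :=
    ((OraclePrimrec.id.left.right.comp hu₁).eq_const 1).and ((hb₂.imp hT₃).and
    (hb₂.not.imp (hb₁.imp ((hT₃.comp hu₂).and
      (Primrec.eq.comp (hu₁.comp hu₂) hu₁).not.oraclePrimrecPred))))
  have hQ : OraclePrimrecPred fun f (p : ℕ × ℕ) =>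
      left (left (left f)) (Nat.pair p.1 p.2) = 1 - f 3 :=
    (OraclePrimrec.id.left.left.left.comp Primrec₂.natPair).eq
      ((OraclePrimrec.oracle (.const 3)).map (Primrec.nat_sub.comp (.const 1) .id))
  obtain ⟨Ψ, hΨ, hΨ'⟩ := exists_thinning hE hQ
  refine le_compProd turingFunctional_colorGraph_code hΦ hΨ ?_
  rintro _ ⟨_, c, K, rfl, hc, hs, H₀, hH₀, hinf₀, hom₀, rfl⟩
  refine ⟨_, maps_some, ?_, ?_⟩
  · simp only [left_join, right_join, setOf_charFn_eq_one]
    exact ⟨_, mem_wRSg_code.2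
      ⟨hinf₀.mono hH₀, H₀, hH₀, hinf₀, (hom₀.isWeakRSr hinf₀ hH₀).isWeakRS, rfl⟩⟩
  simp only [left_join, right_join, setOf_charFn_eq_one, mem_wRSg_code]
  rintro _ ⟨-, H, hH, hinf, hRS, rfl⟩
  refine ⟨_, hΦ' _ _ _ maps_some maps_some, ⟨_, _, _, _, _, rfl, rfl, rfl, rfl⟩, ?_⟩
  rintro _ ⟨p, q, _, _, hpq, rfl, rfl, rfl⟩
  obtain ⟨rfl, rfl⟩ := join_inj.1 hpq
  simp only [left_join, right_join, setOf_charFn_eq_one]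
  set R : ℕ → ℕ → Prop := fun x y => c (Nat.pair x y) = 1 with hR
  set b₁ : ℕ := if ∃ n, (if IsTwoNeighbors H R n then 0 else 1) = 0 then 0 else 1 with hb₁
  set b₂ : ℕ := if ∃ n : ℕ, (if IsTwoNeighbors H R n.unpair.1 ∧ IsTwoNeighbors H R n.unpair.2 ∧
    ¬ n.unpair.1.unpair.1 = n.unpair.2.unpair.1 then 0 else 1) = 0 then 0 else 1 with hb₂
  have hB : ∀ {x}, (∃ w, IsTwoNeighbors H R w ∧ w.unpair.1 = x) ↔
      x ∈ H ∧ (H ∩ (colorGraph c K).neighborSet x).Infinite := hRS.exists_isTwoNeighbors_iff hH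
  set B : Set ℕ := {x ∈ H | (H ∩ (colorGraph c K).neighborSet x).Infinite} with hBdef
  replace hB : ∀ x, x ∈ B ↔ ∃ w, IsTwoNeighbors H R w ∧ w.unpair.1 = x := fun x => hB.symm
  have hBmem : ∀ {w}, IsTwoNeighbors H R w → w.unpair.1 ∈ B := fun {w} hw => (hB _).2 ⟨w, hw, rfl⟩
  have hb₁0 : b₁ = 0 ↔ B.Nonempty := by
    have : b₁ = 0 ↔ ∃ n, IsTwoNeighbors H R n := by simp [hb₁]
    rw [this]
    exact ⟨fun ⟨n, hn⟩ => ⟨_, hBmem hn⟩, fun ⟨x, hx⟩ => ((hB x).1 hx).imp fun w hw => hw.1⟩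
  have hb₂0 : b₂ = 0 ↔ ∃ x ∈ B, ∃ y ∈ B, x ≠ y := by
    have : b₂ = 0 ↔ ∃ n : ℕ, IsTwoNeighbors H R n.unpair.1 ∧ IsTwoNeighbors H R n.unpair.2 ∧
      ¬ n.unpair.1.unpair.1 = n.unpair.2.unpair.1 := by simp [hb₂]
    rw [this]
    constructor
    · rintro ⟨n, h1, h2, h⟩
      exact ⟨_, hBmem h1, _, hBmem h2, h⟩
    · rintro ⟨x, hx, y, hy, h⟩
      obtain ⟨v, hv, rfl⟩ := (hB x).1 hx
      obtain ⟨w, hw, rfl⟩ := (hB y).1 hy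
      exact ⟨Nat.pair v w, by simpa using ⟨hv, hw, h⟩⟩
  have hb₂01 : b₂ = 0 ∨ b₂ = 1 := by
    rw [hb₂]; split_ifs <;> simp
  clear_value b₁ b₂
  set S : Set ℕ := {x ∈ H | x ∈ B ↔ b₂ = 0} with hS
  have hinfS : S.Infinite := by
    by_cases h0 : b₂ = 0
    · obtain ⟨x, hx, y, hy, hxy⟩ := hb₂0.1 h0
      rw [← Nat.frequently_atTop_iff_infinite]
      refine ((Nat.frequently_atTop_iff_infinite.2 hinf).and_eventually
        (((eventually_eq_one hs hH hx.1 hx.2).and (eventually_eq_one hs hH hy.1 hy.2)).and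
          ((eventually_gt_atTop x).and (eventually_gt_atTop y)))).mono ?_
      rintro s ⟨hsH, ⟨hxs, hys⟩, hlx, hly⟩
      replace hsH : s ∈ H := hsH
      -- Since x and y have limit colour 1, they are two neighbours of almost every s in H.
      have hw : IsTwoNeighbors H R (Nat.pair s (Nat.pair x y)) := by
        simp [IsTwoNeighbors, symmRel, hR, hsH, hx.1, hy.1, hxy, hxs hsH, hys hsH, hlx, hly]
      exact ⟨hsH, iff_of_true (by simpa using hBmem hw) h0⟩
    · have hfin : B.Finite := Set.Subsingleton.finite fun x hx y hy =>
        by_contra fun h => h0 (hb₂0.2 ⟨x, hx, y, hy, h⟩)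
      exact (hinf.sdiff hfin).mono fun x hx => ⟨hx.1, iff_of_false hx.2 h0⟩
  have hlim : ∀ x ∈ S, ∀ᶠ s in atTop, s ∈ S → c (Nat.pair x s) = 1 - b₂ := by
    rintro x ⟨hx, hxS⟩
    rcases hb₂01 with h0 | h1
    · exact (eventually_eq_one hs hH hx (hxS.2 h0).2).mono fun s hs hsS => by rw [hs hsS.1, h0]
    · have : ¬ (H ∩ (colorGraph c K).neighborSet x).Infinite := fun h => by
        have := hxS.1 ⟨hx, h⟩
        omega
      exact (eventually_eq_zero hc hH hx this).mono fun s hs hsS => by rw [hs hsS.1, h1]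
  have hiff : ∀ x, x ∈ S ↔ ∃ w : ℕ, (w.unpair.1 ∈ H ∧ (b₂ = 0 → IsTwoNeighbors H R w) ∧
      (¬ b₂ = 0 → b₁ = 0 → IsTwoNeighbors H R w.unpair.2 ∧
        ¬ w.unpair.2.unpair.1 = w.unpair.1)) ∧ w.unpair.1 = x := by
    refine fun x => ⟨fun ⟨hx, hxS⟩ => ?_, ?_⟩
    · by_cases h0 : b₂ = 0
      · obtain ⟨w, hw, rfl⟩ := (hB x).1 (hxS.2 h0)
        exact ⟨w, ⟨hx, fun _ => hw, fun h => absurd h0 h⟩, rfl⟩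
      · by_cases h1 : b₁ = 0
        · obtain ⟨v, hv⟩ := hb₁0.1 h1
          obtain ⟨w, hw, rfl⟩ := (hB v).1 hv
          have hne : ¬ w.unpair.1 = x := fun h => h0 (hxS.1 (h ▸ hv))
          exact ⟨Nat.pair x w, by simp [hx, h0, hw, hne], by simp⟩
        · exact ⟨Nat.pair x 0, by simp [hx, h0, h1], by simp⟩
    · rintro ⟨w, ⟨hw, hw0, hw1⟩, rfl⟩
      refine ⟨hw, fun hwB => ?_, fun h0 => hBmem (hw0 h0)⟩
      by_contra h0
      obtain ⟨hv, hne⟩ := hw1 h0 (hb₁0.2 ⟨_, hwB⟩)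
      exact h0 (hb₂0.2 ⟨_, hBmem hv, _, hwB, hne⟩)
  obtain ⟨H', hH'S, hinf', hhom, hmaps⟩ := hΨ' (join (join (join c (charFn K)) (charFn H))
    (join (fun _ => b₁) fun _ => b₂)) S
    (by simpa [join, charFn_eq_one_iff] using hiff) hinfS (by simpa [join] using hlim)
  refine ⟨_, hmaps, c, K, rfl, hc, hs, H', fun x hx => hH (hH'S hx).1, hinf', ⟨1 - b₂, ?_⟩, rfl⟩
  simpa [join] using hhom

/-! ### Two LPO questions from one graph -/

theorem isWeakRS_setOf_limit {L : ℕ → Prop} {R : ℕ → ℕ → Prop}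
    (h₂ : ∀ x y, L x → ¬ R x y) : IsWeakRS (relGraph Set.univ R) {z | L z} := by
  refine IsWeakRSr.isWeakRS fun x hx => Or.inr (Set.eq_empty_of_forall_notMem fun y hy => ?_)
  obtain ⟨hy, h | h⟩ := (mem_neighborSet_relGraph (Set.subset_univ _) hx).1 hy
  exacts [h₂ x y hx h.2, h₂ y x hy h.2]

/-- Two elements of H outside `L` would both be neighbours of any late z in H, while z has only
finitely many neighbours, because `L` is cofinite and spans no edges. So only the least element of H
can lie outside `L`. -/
theorem IsWeakRS.limit_of_lt {L : ℕ → Prop} {R : ℕ → ℕ → Prop} (hlim : ∀ᶠ z in atTop, L z)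
    (h₁ : ∀ x y, L y → (R x y ↔ ¬ L x)) (h₂ : ∀ x y, L x → ¬ R x y)
    (hmono : ∀ x y, x ≤ y → L x → L y) {H : Set ℕ} (hinf : H.Infinite)
    (hH : IsWeakRS (relGraph Set.univ R) H) {x y : ℕ} (hx : x ∈ H) (hy : y ∈ H) (hxy : x < y) :
    L y := by
  by_contra hLy
  have hLx : ¬ L x := fun h => hLy (hmono x y hxy.le h)
  obtain ⟨z, ⟨hzL, hyz⟩, hz⟩ := ((hlim.and (eventually_gt_atTop y)).and_frequently
    (Nat.frequently_atTop_iff_infinite.2 hinf)).exists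
  replace hz : z ∈ H := hz
  have hmem := fun w => mem_neighborSet_relGraph (R := R) (Set.subset_univ H) (y := w) hz
  refine (hH z hz).elim (fun h => ?_) (not_le.2 (Set.one_lt_encard_iff.2 ⟨x, y, ?_, ?_, hxy.ne⟩))
  · obtain ⟨w, hw, hLw⟩ := ((Nat.frequently_atTop_iff_infinite.2 h).and_eventually hlim).exists
    obtain ⟨-, h | h⟩ := (hmem w).1 hw
    exacts [h₂ z w hzL h.2, h₂ w z hLw h.2]
  · exact (hmem x).2 ⟨hx, Or.inr ⟨hxy.trans hyz, (h₁ x z hzL).2 hLx⟩⟩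
  · exact (hmem y).2 ⟨hy, Or.inr ⟨hyz, (h₁ y z hzL).2 hLy⟩⟩

open Classical in
/-- If all numbers with a given property lead to the same value, then that value can be found by
search. -/
theorem exists_search {P : (ℕ → ℕ) → ℕ → Prop} {F : (ℕ → ℕ) → ℕ → ℕ} (hP : OraclePrimrecPred P)
    (hF : OraclePrimrec F) : ∃ Ψ, TuringFunctional Ψ ∧ ∀ f v, (∃ m, P f m) →
      (∀ m, P f m → F f m = v) → Maps Ψ f fun _ => v := by
  have hrfind := (hP.comp (Primrec.snd (α := ℕ))).rfind
  refine ⟨_, (hF.comp (Primrec.snd.comp .unpair)).turingFunctional.comp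
    ((TuringFunctional.of_primrec .id).pair hrfind), fun f v hex hv n => ?_⟩
  have hfind : Nat.find hex ∈ Nat.rfind fun m => Part.some (decide (P f m)) :=
    Nat.mem_rfind.2 ⟨by simpa using Nat.find_spec hex, fun {m} hm => by
      simpa using Nat.find_min hex hm⟩
  refine Part.mem_bind_iff.2 ⟨_, Part.mem_bind_iff.2 ⟨_, Part.mem_some _,
    (Part.mem_map_iff _).2 ⟨_, hfind, rfl⟩⟩, ?_⟩
  simp [hv _ (Nat.find_spec hex)]

/-- `p` has a zero among its first values up to `x`. -/
def HasZeroUpTo (p : ℕ → ℕ) (x : ℕ) : Prop := ∃ n < x + 1, p n = 0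

theorem HasZeroUpTo.mono {p : ℕ → ℕ} {x y : ℕ} (h : x ≤ y) : HasZeroUpTo p x → HasZeroUpTo p y :=
  fun ⟨n, hn, h0⟩ => ⟨n, by omega, h0⟩

theorem HasZeroUpTo.exists {p : ℕ → ℕ} {x : ℕ} : HasZeroUpTo p x → ∃ n, p n = 0 :=
  fun ⟨n, _, h0⟩ => ⟨n, h0⟩

theorem eventually_hasZeroUpTo {p : ℕ → ℕ} (h : ∃ n, p n = 0) :
    ∀ᶠ x in atTop, HasZeroUpTo p x := by
  obtain ⟨n, hn⟩ := h
  filter_upwards [eventually_ge_atTop n] with x hx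
  exact ⟨n, by omega, hn⟩

/-- Join x < y when the first zero of p or of q occurs in (x, y]. The second element of any solution
is then past the first zeros of both sequences, where they exist, and bounds both searches. -/
theorem LPO_prod_LPO_le_wRSg : LPO.prod LPO ≤ᵂ wRSg := by
  classical
  have hZ : ∀ {F : (ℕ → ℕ) → ℕ → ℕ}, OraclePrimrec F →
      OraclePrimrecPred fun f x => HasZeroUpTo (F f) x := fun {F} hF =>
    OraclePrimrecPred.exists_lt (P := fun f (q : ℕ × ℕ) => F f q.1 = 0)
      ((hF.comp .fst).eq_const 0) .succ
  have hd : ∀ {F : (ℕ → ℕ) → ℕ → ℕ}, OraclePrimrec F → OraclePrimrecPred fun f (q : ℕ × ℕ) =>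
      HasZeroUpTo (F f) q.2 ∧ ¬ HasZeroUpTo (F f) q.1 := fun hF =>
    ((hZ hF).comp .snd).and ((hZ hF).comp .fst).not
  have hcode := TuringFunctional.relGraph_code (K := fun _ => Set.univ)
    (R := fun f x y => (HasZeroUpTo (left f) y ∧ ¬ HasZeroUpTo (left f) x) ∨
      (HasZeroUpTo (right f) y ∧ ¬ HasZeroUpTo (right f) x))
    (((Primrec.eq (α := ℕ)).comp .id .id).oraclePrimrecPred.of_iff fun _ _ => by simp)
    ((hd OraclePrimrec.id.left).or (hd OraclePrimrec.id.right))
  have hu₁ : Primrec fun n : ℕ => n.unpair.1 := Primrec.fst.comp .unpair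
  have hu₂ : Primrec fun n : ℕ => n.unpair.2 := Primrec.snd.comp .unpair
  -- Any two elements of the solution will do: the larger one is a valid bound.
  have hH : OraclePrimrecPred fun f (m : ℕ) => m.unpair.1 < m.unpair.2 ∧
      right f m.unpair.1 = 1 ∧ right f m.unpair.2 = 1 :=
    (Primrec.nat_lt.comp hu₁ hu₂).oraclePrimrecPred.and
      (((OraclePrimrec.id.right.comp hu₁).eq_const 1).and
        ((OraclePrimrec.id.right.comp hu₂).eq_const 1))
  have hout : ∀ {F : (ℕ → ℕ) → ℕ → ℕ}, OraclePrimrec F → OraclePrimrec fun f (m : ℕ) =>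
      if HasZeroUpTo (F f) m.unpair.2 then 0 else 1 := fun {F} hF =>
    ((hZ hF).comp hu₂).ite (Primrec.const 0).oraclePrimrec (Primrec.const 1).oraclePrimrec
  obtain ⟨Ψ₁, hΨ₁, hΨ₁'⟩ := exists_search hH (hout OraclePrimrec.id.left.left)
  obtain ⟨Ψ₂, hΨ₂, hΨ₂'⟩ := exists_search hH (hout OraclePrimrec.id.left.right)
  obtain ⟨Ψ, hΨ, hΨ'⟩ := hΨ₁.exists_join hΨ₂
  refine ⟨_, Ψ, hcode, hΨ, ?_⟩
  rintro _ ⟨_, p, q, a, b, rfl, -, -, -⟩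
  refine ⟨_, maps_some, ?_⟩
  simp only [left_join, right_join]
  set R : ℕ → ℕ → Prop := fun x y => (HasZeroUpTo p y ∧ ¬ HasZeroUpTo p x) ∨
    (HasZeroUpTo q y ∧ ¬ HasZeroUpTo q x) with hR
  let L : ℕ → Prop := fun z =>
    ((∃ n, p n = 0) → HasZeroUpTo p z) ∧ ((∃ n, q n = 0) → HasZeroUpTo q z)
  have hlim : ∀ᶠ z in atTop, L z :=
    (eventually_imp_distrib_left.2 eventually_hasZeroUpTo).and
      (eventually_imp_distrib_left.2 eventually_hasZeroUpTo)
  have hmono : ∀ x y, x ≤ y → L x → L y := fun x y hxy h =>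
    ⟨fun he => (h.1 he).mono hxy, fun he => (h.2 he).mono hxy⟩
  have h₂ : ∀ x y, L x → ¬ R x y := by
    rintro x y hx (h | h)
    exacts [h.2 (hx.1 h.1.exists), h.2 (hx.2 h.1.exists)]
  have h₁ : ∀ x y, L y → (R x y ↔ ¬ L x) := fun x y hy => by
    refine ⟨fun h hx => h₂ x y hx h, fun hx => ?_⟩
    by_contra hcon
    refine hx ⟨fun he => ?_, fun he => ?_⟩
    · exact by_contra fun h => hcon (Or.inl ⟨hy.1 he, h⟩)
    · exact by_contra fun h => hcon (Or.inr ⟨hy.2 he, h⟩)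
  refine ⟨⟨_, mem_wRSg_code.2 ⟨Set.infinite_univ, {z | L z}, Set.subset_univ _,
    Nat.frequently_atTop_iff_infinite.1 hlim.frequently, isWeakRS_setOf_limit h₂, rfl⟩⟩, ?_⟩
  intro g hg
  obtain ⟨-, H, -, hinf, hRS, rfl⟩ := mem_wRSg_code.1 hg
  have key := fun {x y} => hRS.limit_of_lt (x := x) (y := y) hlim h₁ h₂ hmono hinf
  have hex : ∃ m : ℕ, m.unpair.1 < m.unpair.2 ∧ right (join (join p q) (charFn H)) m.unpair.1 = 1 ∧
      right (join (join p q) (charFn H)) m.unpair.2 = 1 := by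
    obtain ⟨x, hx⟩ := hinf.nonempty
    obtain ⟨y, hy, hxy⟩ := hinf.exists_gt x
    exact ⟨Nat.pair x y, by simp [charFn_eq_one_iff, hx, hy, hxy]⟩
  refine ⟨_, hΨ' _ _ _ (hΨ₁' _ _ hex ?_) (hΨ₂' _ _ hex ?_), p, q, _, _, rfl, rfl, rfl, rfl⟩
  · rintro m ⟨hlt, hm₁, hm₂⟩
    rw [right_join, charFn_eq_one_iff] at hm₁ hm₂
    have : HasZeroUpTo p m.unpair.2 ↔ ∃ n, p n = 0 := ⟨HasZeroUpTo.exists, (key hm₁ hm₂ hlt).1⟩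
    simp [this]
  · rintro m ⟨hlt, hm₁, hm₂⟩
    rw [right_join, charFn_eq_one_iff] at hm₁ hm₂
    have : HasZeroUpTo q m.unpair.2 ↔ ∃ n, q n = 0 := ⟨HasZeroUpTo.exists, (key hm₁ hm₂ hlt).2⟩
    simp [this]

/-! ### Making a colouring stable on an infinite set -/

/-- The colours of the pairs `{i, x}` with `i < x`, continued by zeros. -/
def colorSeq (c : ℕ → ℕ) (x i : ℕ) : ℕ := if i < x then c (Nat.pair i x) else 0

/-- The lexicographic order of the sequences of colours. -/
def ColorLT (c : ℕ → ℕ) (x y : ℕ) : Prop := toLex (colorSeq c x) < toLex (colorSeq c y)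

/-- The sequence of y vanishes from y on, so it cannot exceed another one there. The bound makes the
order decidable in c. -/
theorem colorLT_iff {c : ℕ → ℕ} {x y : ℕ} : ColorLT c x y ↔
    ∃ i < y, (∀ j < i, colorSeq c x j = colorSeq c y j) ∧ colorSeq c x i < colorSeq c y i := by
  constructor
  · rintro ⟨i, hi, hlt⟩
    refine ⟨i, ?_, hi, hlt⟩
    by_contra h
    have : colorSeq c y i = 0 := if_neg h
    exact absurd hlt (by simp [this])
  · rintro ⟨i, -, hi, hlt⟩
    exact ⟨i, hi, hlt⟩

theorem OraclePrimrecPred.colorLT {F : (ℕ → ℕ) → ℕ → ℕ} (hF : OraclePrimrec F) :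
    OraclePrimrecPred fun f (p : ℕ × ℕ) => ColorLT (F f) p.1 p.2 := by
  have hseq : OraclePrimrec fun f (p : ℕ × ℕ) => colorSeq (F f) p.1 p.2 := by
    refine ((Primrec.nat_lt.comp .snd .fst).oraclePrimrecPred.ite
      (hF.comp (Primrec₂.natPair.comp .snd .fst)) (Primrec.const 0).oraclePrimrec).of_eq
        fun f p => ?_
    unfold colorSeq
    congr
  have h₁ : OraclePrimrecPred fun f (q : ℕ × ℕ × ℕ × ℕ) =>
      colorSeq (F f) q.2.2.1 q.1 = colorSeq (F f) q.2.2.2 q.1 :=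
    (hseq.comp (Primrec.pair (Primrec.fst.comp (Primrec.snd.comp .snd)) .fst)).eq
      (hseq.comp (Primrec.pair (Primrec.snd.comp (Primrec.snd.comp .snd)) .fst))
  have h₂ : OraclePrimrecPred fun f (q : ℕ × ℕ × ℕ) =>
      colorSeq (F f) q.2.1 q.1 < colorSeq (F f) q.2.2 q.1 :=
    (hseq.comp (Primrec.pair (Primrec.fst.comp .snd) .fst)).rel
      (hseq.comp (Primrec.pair (Primrec.snd.comp .snd) .fst)) Primrec.nat_lt
  exact (((h₁.forall_lt Primrec.fst).and h₂).exists_lt Primrec.snd).of_iff fun f p => colorLT_iff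

/-- Sequences of bits that are eventually monotone in the lexicographic order (in one of the two
directions) converge. -/
theorem eventually_const_of_lex {t : ℕ → ℕ → ℕ} {r : ℕ → ℕ → Prop} (hr : ¬ (r 0 1 ∧ r 1 0))
    (ht : ∀ n i, t n i = 0 ∨ t n i = 1)
    (h : ∀ᶠ m in atTop, ∀ᶠ n in atTop, ∀ i, (∀ j < i, t m j = t n j) → r (t m i) (t n i)) (i : ℕ) :
    ∃ d, ∀ᶠ n in atTop, t n i = d := by
  induction i using Nat.strong_induction_on with
  | _ i ih =>
    choose! d hd using ih
    have hd' : ∀ᶠ n in atTop, ∀ j ∈ Set.Iio i, t n j = d j :=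
      (eventually_all_finite (Set.finite_Iio i)).2 hd
    by_contra! hcon
    -- Once the entries before i have settled, monotonicity applies to entry i, so two values taken
    -- infinitely often are related both ways.
    have key : ∀ a b, (∃ᶠ n in atTop, t n i = a) → (∃ᶠ n in atTop, t n i = b) → r a b := by
      intro a b ha hb
      obtain ⟨m, rfl, hm, hmd⟩ := (ha.and_eventually (h.and hd')).exists
      obtain ⟨n, rfl, hn, hnd⟩ := (hb.and_eventually (hm.and hd')).exists
      exact hn i fun j hj => (hmd j hj).trans (hnd j hj).symm
    have h0 : ∃ᶠ n in atTop, t n i = 0 := by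
      refine (hcon 1).mono fun n hn => (ht n i).resolve_right hn
    have h1 : ∃ᶠ n in atTop, t n i = 1 := by
      refine (hcon 0).mono fun n hn => (ht n i).resolve_left hn
    exact hr ⟨key 0 1 h0 h1, key 1 0 h1 h0⟩

theorem colorSeq_le_of_le {c : ℕ → ℕ} {x y i : ℕ} (h : ¬ ColorLT c y x)
    (hi : ∀ j < i, colorSeq c x j = colorSeq c y j) : colorSeq c x i ≤ colorSeq c y i :=
  not_lt.1 fun hlt => h ⟨i, fun j hj => (hi j hj).symm, hlt⟩

/-- Lexicographic order is transitive, so some subsequence is increasing (every vertex has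
infinitely many neighbours) or nonincreasing (no edges). -/
theorem exists_isWeakRS_colorLT (c : ℕ → ℕ) :
    ∃ H : Set ℕ, H.Infinite ∧ IsWeakRS (relGraph Set.univ (ColorLT c)) H := by
  have : IsTrans ℕ (ColorLT c) := ⟨fun x y z => lt_trans (α := Lex (ℕ → ℕ))⟩
  obtain ⟨g, hg⟩ := exists_increasing_or_nonincreasing_subseq (ColorLT c) id
  refine ⟨Set.range g, Set.infinite_range_of_injective g.injective, IsWeakRSr.isWeakRS ?_⟩
  rintro _ ⟨m, rfl⟩
  have hmem := fun y => mem_neighborSet_relGraph (R := ColorLT c)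
    (Set.subset_univ (Set.range g)) (y := y) ⟨m, rfl⟩
  rcases hg with hg | hg
  · left
    refine ((Set.Ioi_infinite m).image g.injective.injOn).mono ?_
    rintro _ ⟨n, hn, rfl⟩
    exact (hmem _).2 ⟨⟨n, rfl⟩, Or.inl ⟨g.strictMono hn, hg m n hn⟩⟩
  · right
    refine Set.eq_empty_of_forall_notMem fun y hy => ?_
    obtain ⟨⟨n, rfl⟩, h | h⟩ := (hmem _).1 hy
    · exact hg m n (g.lt_iff_lt.1 h.1) h.2
    · exact hg n m (g.lt_iff_lt.1 h.1) h.2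

/-- Needed for the constructed instance to lie in the domain: one limit colour occurs infinitely
often, and those points can be thinned out. -/
theorem IsStableOn.exists_isHomogeneous {c : ℕ → ℕ} {K : Set ℕ} (hc : IsColoring c)
    (hs : IsStableOn c K) (hK : K.Infinite) : ∃ H ⊆ K, H.Infinite ∧ IsHomogeneous c H := by
  let S : ℕ → Set ℕ := fun i => {x ∈ K | ∀ᶠ s in atTop, s ∈ K → c (Nat.pair x s) = i}
  have hcover : K ⊆ S 0 ∪ S 1 := by
    intro x hx
    obtain ⟨i, hi⟩ := hs x hx
    obtain ⟨s, ⟨hsi, hxs⟩, hsK⟩ := ((hi.and (eventually_gt_atTop x)).and_frequently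
      (Nat.frequently_atTop_iff_infinite.2 hK)).exists
    rcases hc x s hxs with h | h
    · exact Or.inl ⟨hx, hi.mono fun s' h' hK' => by rw [h' hK', ← hsi hsK, h]⟩
    · exact Or.inr ⟨hx, hi.mono fun s' h' hK' => by rw [h' hK', ← hsi hsK, h]⟩
  obtain ⟨i, hi⟩ : ∃ i, (S i).Infinite :=
    (Set.infinite_union.1 (hK.mono hcover)).elim (fun h => ⟨0, h⟩) fun h => ⟨1, h⟩
  obtain ⟨x, hx, hr⟩ := exists_seq_of_forall_finset_exists (· ∈ S i)
    (fun x y => x < y ∧ c (Nat.pair x y) = i) fun F hF => by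
      have : ∀ᶠ s in atTop, ∀ x ∈ F, x < s ∧ (s ∈ K → c (Nat.pair x s) = i) :=
        (eventually_all_finset F).2 fun x hx => (eventually_gt_atTop x).and (hF x hx).2
      obtain ⟨s, hs, hsS⟩ :=
        (this.and_frequently (Nat.frequently_atTop_iff_infinite.2 hi)).exists
      replace hsS : s ∈ S i := hsS
      exact ⟨s, hsS, fun x hx => ⟨(hs x hx).1, (hs x hx).2 hsS.1⟩⟩
  have hmono : StrictMono x := fun m n hmn => (hr m n hmn).1
  refine ⟨Set.range x, ?_, Set.infinite_range_of_injective hmono.injective, i, ?_⟩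
  · rintro _ ⟨n, rfl⟩
    exact (hx n).1
  · rintro _ ⟨m, rfl⟩ _ ⟨n, rfl⟩ hmn
    exact (hr m n (hmono.lt_iff_lt.1 hmn)).2

theorem isStableOn_range {c x : ℕ → ℕ} (hx : StrictMono x)
    (h : ∀ i, ∃ d, ∀ᶠ n in atTop, colorSeq c (x n) i = d) : IsStableOn c (Set.range x) := by
  intro i _
  obtain ⟨d, hd⟩ := h i
  obtain ⟨N, hN⟩ := eventually_atTop.1 (hd.and (hx.tendsto_atTop.eventually_gt_atTop i))
  refine ⟨d, ?_⟩
  filter_upwards [eventually_ge_atTop (x N)] with s hs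
  rintro ⟨n, rfl⟩
  obtain ⟨h₁, h₂⟩ := hN n (hx.le_iff_le.1 hs)
  rwa [colorSeq, if_pos h₂] at h₁

section Cohesive

variable {c : ℕ → ℕ} {H : Set ℕ}

/-- The vertices of `H` with at least two neighbours in `H`. -/
def bigDegree (H : Set ℕ) (R : ℕ → ℕ → Prop) : Set ℕ :=
  {x | ∃ w, IsTwoNeighbors H R w ∧ w.unpair.1 = x}

/-- Only finitely many neighbours of x are smaller than x, so infinite degree is decided by the
later ones, which are lexicographically above x. -/
theorem mem_bigDegree_colorLT (hH : IsWeakRS (relGraph Set.univ (ColorLT c)) H) {x : ℕ} :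
    x ∈ bigDegree H (ColorLT c) ↔ x ∈ H ∧ {y ∈ H | ColorLT c x y}.Infinite := by
  refine (hH.exists_isTwoNeighbors_iff H.subset_univ).trans (and_congr_right fun hx => ?_)
  refine Iff.trans (b := ∃ᶠ y in atTop, y ∈ H ∩ (relGraph Set.univ (ColorLT c)).neighborSet x)
    Nat.frequently_atTop_iff_infinite.symm
    (Iff.trans (frequently_congr ?_) Nat.frequently_atTop_iff_infinite)
  filter_upwards [eventually_gt_atTop x] with y hy
  refine (mem_neighborSet_relGraph (Set.subset_univ H) hx).trans (and_congr_right fun _ => ?_)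
  simp [symmRel, hy, hy.not_gt]

/-- Having infinitely many elements of H above is inherited downwards, so an element of H outside B,
the set of vertices of large degree, lies above all of B. If it also exceeds a and b numerically,
these are two neighbours of it, putting it in B. So B is cofinite in H and has no lexicographically
maximal element. -/
theorem infinite_bigDegree_colorLT (hH : IsWeakRS (relGraph Set.univ (ColorLT c)) H) {a b x : ℕ}
    (ha : a ∈ bigDegree H (ColorLT c)) (hb : b ∈ bigDegree H (ColorLT c)) (hab : a ≠ b)
    (hx : x ∈ bigDegree H (ColorLT c)) : {y ∈ bigDegree H (ColorLT c) | ColorLT c x y}.Infinite := by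
  have habove : ∀ z ∈ bigDegree H (ColorLT c), ∀ y ∈ H, y ∉ bigDegree H (ColorLT c) →
      ColorLT c z y := by
    intro z hz y hy hyB
    by_contra hzy
    refine hyB ((mem_bigDegree_colorLT hH).2 ⟨hy, ((mem_bigDegree_colorLT hH).1 hz).2.mono ?_⟩)
    exact fun s hs => ⟨hs.1, lt_of_le_of_lt (α := Lex (ℕ → ℕ)) (not_lt.1 hzy) hs.2⟩
  have hcofin : ∀ᶠ y in atTop, y ∈ H → y ∈ bigDegree H (ColorLT c) := by
    filter_upwards [eventually_gt_atTop a, eventually_gt_atTop b] with y hay hby hy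
    by_contra hyB
    refine hyB ⟨Nat.pair y (Nat.pair a b), ?_, by simp⟩
    simp [IsTwoNeighbors, symmRel, hy, hab, hay, hby, ((mem_bigDegree_colorLT hH).1 ha).1,
      ((mem_bigDegree_colorLT hH).1 hb).1, habove a ha y hy hyB, habove b hb y hy hyB]
  have hinf := Nat.frequently_atTop_iff_infinite.2 ((mem_bigDegree_colorLT hH).1 hx).2
  exact Nat.frequently_atTop_iff_infinite.1
    ((hinf.and_eventually hcofin).mono fun y hy => ⟨hy.2 hy.1.1, hy.1.2⟩)

end Cohesive

open Classical in
-- The greedy construction lists H until two vertices of B have been certified, and from then on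
-- picks lexicographically increasing elements of B. If this never happens, B has at most one
-- element, and H is already eventually nonincreasing.
theorem RTPairs_le_SRTPairsOn_wRSg : RTPairs ≤ᵂ SRTPairsOn ∗ wRSg := by
  have hcode := TuringFunctional.relGraph_code (K := fun _ => Set.univ) (R := ColorLT)
    (((Primrec.eq (α := ℕ)).comp .id .id).oraclePrimrecPred.of_iff fun _ _ => by simp)
    (.colorLT .id)
  have hu₁ : Primrec fun n : ℕ => n.unpair.1 := Primrec.fst.comp .unpair
  have hu₂ : Primrec fun n : ℕ => n.unpair.2 := Primrec.snd.comp .unpair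
  have hLT : OraclePrimrecPred fun f (p : ℕ × ℕ) => ColorLT (left f) p.1 p.2 :=
    .colorLT OraclePrimrec.id.left
  have hT : OraclePrimrecPred fun f w => IsTwoNeighbors {x | right f x = 1} (ColorLT (left f)) w :=
    .isTwoNeighbors (OraclePrimrec.id.right.eq_const 1) hLT
  -- The search for two certificates is bounded by the stage, i.e. the length of the history; this
  -- keeps the admissibility condition decidable.
  have hD : OraclePrimrecPred fun f (q : List ℕ × ℕ) => ∃ d < q.1.length,
      IsTwoNeighbors {x | right f x = 1} (ColorLT (left f)) d.unpair.1 ∧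
      IsTwoNeighbors {x | right f x = 1} (ColorLT (left f)) d.unpair.2 ∧
      ¬ d.unpair.1.unpair.1 = d.unpair.2.unpair.1 :=
    (((hT.comp hu₁).and ((hT.comp hu₂).and
      (Primrec.eq.comp (hu₁.comp hu₁) (hu₁.comp hu₂)).not.oraclePrimrecPred)).comp
        Primrec.fst).exists_lt (Primrec.list_length.comp Primrec.fst)
  have hx : Primrec fun p : ℕ × List ℕ × ℕ => p.1.unpair.1 := hu₁.comp .fst
  have hy : Primrec fun p : ℕ × List ℕ × ℕ => p.2.2.unpair.1 :=
    hu₁.comp (Primrec.snd.comp .snd)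
  have hE : OraclePrimrecPred fun f (p : List ℕ × ℕ) => right f p.2.unpair.1 = 1 ∧
      (∀ x ∈ p.1, x.unpair.1 < p.2.unpair.1 ∧
        (IsTwoNeighbors {x | right f x = 1} (ColorLT (left f)) x →
        (∃ d < p.1.length, IsTwoNeighbors {x | right f x = 1} (ColorLT (left f)) d.unpair.1 ∧
          IsTwoNeighbors {x | right f x = 1} (ColorLT (left f)) d.unpair.2 ∧
          ¬ d.unpair.1.unpair.1 = d.unpair.2.unpair.1) →
        ColorLT (left f) x.unpair.1 p.2.unpair.1)) ∧
      ((∃ d < p.1.length, IsTwoNeighbors {x | right f x = 1} (ColorLT (left f)) d.unpair.1 ∧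
          IsTwoNeighbors {x | right f x = 1} (ColorLT (left f)) d.unpair.2 ∧
          ¬ d.unpair.1.unpair.1 = d.unpair.2.unpair.1) →
        IsTwoNeighbors {x | right f x = 1} (ColorLT (left f)) p.2) :=
    ((OraclePrimrec.id.right.comp (hu₁.comp (Primrec.snd (α := List ℕ)))).eq_const 1).and
    ((((Primrec.nat_lt.comp hx hy).oraclePrimrecPred.and ((hT.comp Primrec.fst).imp
      ((hD.comp Primrec.snd).imp (hLT.comp (Primrec.pair hx hy))))).forall_mem Primrec.fst).and
      (hD.imp (hT.comp Primrec.snd)))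
  obtain ⟨Ψ, hΨ, hΨ'⟩ := exists_greedy hE
  obtain ⟨Φ, hΦ, hΦ'⟩ := TuringFunctional.oracle_left.exists_join hΨ
  refine le_compProd hcode hΦ .oracle_right ?_
  rintro c ⟨_, hc, -⟩
  obtain ⟨H₀, hinf₀, hRS₀⟩ := exists_isWeakRS_colorLT c
  refine ⟨_, maps_some, ⟨_, mem_wRSg_code.2
    ⟨Set.infinite_univ, H₀, H₀.subset_univ, hinf₀, hRS₀, rfl⟩⟩, fun g hg => ?_⟩
  obtain ⟨-, H, -, hinf, hRS, rfl⟩ := mem_wRSg_code.1 hg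
  suffices ∃ x : ℕ → ℕ, StrictMono x ∧
      Maps Ψ (join c (charFn H)) (charFn (Set.range x)) ∧ IsStableOn c (Set.range x) by
    obtain ⟨x, hx, hmaps, hs⟩ := this
    have hxinf := Set.infinite_range_of_injective hx.injective
    refine ⟨_, hΦ' _ _ _ (maps_left _ _) hmaps, ?_, ?_⟩
    · obtain ⟨H', hH', hinf', hom'⟩ := hs.exists_isHomogeneous hc hxinf
      exact ⟨_, c, _, rfl, hc, hs, H', hH', hinf', hom', rfl⟩
    · rintro _ ⟨c', K', hj, -, -, H', -, hinf', hom', rfl⟩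
      obtain ⟨rfl, -⟩ := join_inj.1 hj
      exact ⟨_, maps_right _ _, hc, H', hinf', hom', rfl⟩
  have key := hΨ' (join c (charFn H)) (fun _ => True) trivial
  simp only [left_join, right_join, charFn_eq_one_iff, true_and, forall_const,
    implies_true] at key
  set T : ℕ → Prop := IsTwoNeighbors H (ColorLT c) with hTdef
  set D : ℕ → Prop := fun n => ∃ d < n, T d.unpair.1 ∧ T d.unpair.2 ∧
    ¬ d.unpair.1.unpair.1 = d.unpair.2.unpair.1 with hDdef
  set B := bigDegree H (ColorLT c) with hBdef
  have hTB : ∀ {w}, T w → w.unpair.1 ∈ B := fun {w} hw => ⟨w, hw, rfl⟩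
  have hgt : ∀ σ : List ℕ, ∀ᶠ y in atTop, ∀ x ∈ {x | x ∈ σ}, x.unpair.1 < y := fun σ =>
    (eventually_all_finite σ.finite_toSet).2 fun x _ => eventually_gt_atTop _
  have hex : ∀ σ : List ℕ, ∃ w : ℕ, w.unpair.1 ∈ H ∧ (∀ x ∈ σ, x.unpair.1 < w.unpair.1 ∧
      (T x → D σ.length → ColorLT c x.unpair.1 w.unpair.1)) ∧ (D σ.length → T w) := by
    intro σ
    by_cases hd : D σ.length
    · obtain ⟨d, -, ha, hb, hab⟩ := hd
      -- Elements of B above a maximal m are above every certified entry of the history. Starting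
      -- from a vertex known to be in B covers histories with no certified entry.
      have hmax : ∀ σ : List ℕ, ∃ m ∈ B, ∀ x ∈ σ, T x → ¬ ColorLT c m x.unpair.1 := by
        intro σ
        induction σ with
        | nil => exact ⟨_, hTB ha, by simp⟩
        | cons z σ ih =>
          obtain ⟨m, hm, hmax⟩ := ih
          by_cases hz : T z ∧ ColorLT c m z.unpair.1
          · refine ⟨_, hTB hz.1, fun x hx hTx hlt => ?_⟩
            rcases List.mem_cons.1 hx with rfl | hx
            · exact lt_irrefl (α := Lex (ℕ → ℕ)) _ hlt
            · exact hmax x hx hTx (lt_trans (α := Lex (ℕ → ℕ)) hz.2 hlt)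
          · refine ⟨m, hm, fun x hx hTx hlt => ?_⟩
            rcases List.mem_cons.1 hx with rfl | hx
            exacts [hz ⟨hTx, hlt⟩, hmax x hx hTx hlt]
      obtain ⟨m, hm, hmax⟩ := hmax σ
      obtain ⟨_, hσ, ⟨w, hw, rfl⟩, hmw⟩ := ((hgt σ).and_frequently
        (Nat.frequently_atTop_iff_infinite.2
          (infinite_bigDegree_colorLT hRS (hTB ha) (hTB hb) hab hm))).exists
      exact ⟨w, hw.1, fun x hx => ⟨hσ x hx, fun hTx _ =>
        lt_of_le_of_lt (α := Lex (ℕ → ℕ)) (not_lt.1 (hmax x hx hTx)) hmw⟩, fun _ => hw⟩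
    · obtain ⟨y, hσ, hy⟩ := ((hgt σ).and_frequently
        (Nat.frequently_atTop_iff_infinite.2 hinf)).exists
      replace hy : y ∈ H := hy
      refine ⟨Nat.pair y 0, by simpa using hy, fun x hx => ⟨by simpa using hσ x hx, ?_⟩, ?_⟩
      exacts [fun _ h => absurd h hd, fun h => absurd h hd]
  obtain ⟨w, hw, hmaps⟩ := key hex fun σ w h => fun x hx => (h.2.1 x hx).1
  simp only [length_history] at hw
  have hmono : StrictMono fun n => (w n).unpair.1 := strictMono_nat_of_lt_succ fun n =>
    ((hw (n + 1)).2.1 _ (mem_history.2 ⟨n, n.lt_succ_self, rfl⟩)).1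
  refine ⟨_, hmono, hmaps, isStableOn_range hmono ?_⟩
  have h01 : ∀ n i, colorSeq c (w n).unpair.1 i = 0 ∨ colorSeq c (w n).unpair.1 i = 1 := by
    intro n i
    unfold colorSeq
    split_ifs with h
    exacts [hc _ _ h, Or.inl rfl]
  by_cases hd : ∃ n, D n
  · obtain ⟨N, hN⟩ := hd
    have hD : ∀ n ≥ N, D n := fun n hn => hN.imp fun d hd => ⟨hd.1.trans_le hn, hd.2⟩
    refine eventually_const_of_lex (r := (· ≤ ·)) (by simp) h01 ?_
    filter_upwards [eventually_ge_atTop N] with m hm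
    filter_upwards [eventually_gt_atTop m] with n hn i
    refine colorSeq_le_of_le fun hlt => lt_asymm (α := Lex (ℕ → ℕ)) hlt ?_
    exact ((hw n).2.1 _ (mem_history.2 ⟨m, hn, rfl⟩)).2 ((hw m).2.2 (hD m hm))
      (hD n (hm.trans hn.le))
  -- Two distinct elements of B would give a code d of two certificates, noticed at stage d + 1.
  · have hsub : B.Subsingleton := by
      rintro _ ⟨a, ha, rfl⟩ _ ⟨b, hb, rfl⟩
      by_contra hab
      exact hd ⟨_, Nat.pair a b, Nat.lt_succ_self _, by simpa using ⟨ha, hb, hab⟩⟩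
    have hev : ∀ᶠ y in atTop, y ∉ B :=
      not_frequently.1 fun h => hsub.finite.not_infinite (Nat.frequently_atTop_iff_infinite.1 h)
    have hnB : ∀ᶠ n in atTop, (w n).unpair.1 ∉ B := hmono.tendsto_atTop.eventually hev
    refine eventually_const_of_lex (r := (· ≥ ·)) (by simp) h01 ?_
    filter_upwards [hnB] with m hm
    -- Outside B only finitely many elements of H are above, so later sequences are eventually at
    -- most this one.
    have hfin : ∀ᶠ y in atTop, ¬ (y ∈ H ∧ ColorLT c (w m).unpair.1 y) :=
      not_frequently.1 fun h => hm ((mem_bigDegree_colorLT hRS).2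
        ⟨(hw m).1, Nat.frequently_atTop_iff_infinite.1 h⟩)
    filter_upwards [hmono.tendsto_atTop.eventually hfin] with n hn i hi
    exact colorSeq_le_of_le (fun h => hn ⟨(hw n).1, h⟩) fun j hj => (hi j hj).symm

end Weihrauch

theorem mainTheorem11 :
    (∀ F G : Problem, IsCompositionalProduct F G (F ∗ G)) ∧
    SRTPairs ≤ᵂ LPO ∗ wRSgr ∧
    SRTPairs ≤ᵂ (LPO.prod LPO) ∗ wRSg ∧
    RTPairs ≤ᵂ wRSg ∗ wRSg ∗ wRSg :=
  ⟨isCompositionalProduct_compProd,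
    SRTPairs_le_SRTPairsOn.trans SRTPairsOn_le_LPO_wRSgr,
    SRTPairs_le_SRTPairsOn.trans SRTPairsOn_le_LPO_prod_LPO_wRSg,
    RTPairs_le_SRTPairsOn_wRSg.trans (compProd_mono
      (SRTPairsOn_le_LPO_prod_LPO_wRSg.trans (compProd_mono LPO_prod_LPO_le_wRSg (.refl _)))
      (.refl _))⟩
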